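/- Let $\mathfrak H$ be a real separable Hilbert space and $X=\{X(h):h\in\mathfrak H\}$ an isonormal Gaussian process on a probability space $(\Omega,\mathscr F,P)$, that is, a centered jointly Gaussian family with $E[X(g)X(h)]=\langle g,h\rangle$. Let $D$ be the Malliavin derivative (the closure in $L^2(\Omega)\times L^2(\Omega;\mathfrak H)$ of the derivative on smooth random variables), let $L^{-1}F=-\sum_{p\ge 1}\frac1p J_pF$, where $J_p$ is the orthogonal projection onto the $p$-th Wiener chaos, and let $\Gamma_0(F)=F$, $\Gamma_{r+1}(F)=\langle D\Gamma_r(F),-DL^{-1}F\rangle_{\mathfrak H}$. For $\nu>0$ let $G(\nu)$ have the law of $2\widehat G-\nu$, where $\widehat G$ is Gamma distributed with shape $\nu/2$ and rate $1$. Let $\nu>0$ be real and let $M_n\in\mathbb N\cup\{+\infty\}$ be nondecreasing in $n$ with $M_n\to\infty$. Let $(F_n)_{n\ge1}$ be a sequence in the second Wiener chaos of $X$ with $E[F_n^2]=2\nu$ for all $n$ and with the representation, convergent in $L^2$, $$F_n=\sum_{1\le i\le M_n}c_{i,n}\,(N_{i,n}^2-1),\qquad N_{i,n}=X(e_{i,n}),$$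 where for each $n$ the $e_{i,n}$, $1\le i\le M_n$, are orthonormal in $\mathfrak H$ (so that the $N_{i,n}$ are independent standard normal variables) and $|c_{1,n}|\ge|c_{2,n}|\ge\cdots$. Put $c_{i,n}=0$ for $i>M_n$. Assume that $F_n$ converges in distribution to $G(\nu)$. Then $\nu$ is a positive integer. With $$\omega(n)=\max_{1\le i\le\nu}|1-c_{i,n}|,\qquad \vartheta(n)=\sum_{i>\nu}c_{i,n}^2,$$ and with $a_n\approx b_n$ for nonnegative sequences meaning that there are constants $0<k\le K$ (independent of $n$) with $k\,b_n\le a_n\le K\,b_n$ for all sufficiently large $n$, one has $$\operatorname{Var}\bigl(\Gamma_3(F_n)-2\Gamma_2(F_n)\bigr)\approx \operatorname{Var}\bigl(\Gamma_1(F_n)-2F_n\bigr)^2\quad\Longleftrightarrow\quad \vartheta(n)\approx\omega(n).$$ Moreover, if $\vartheta(n)\approx\omega(n)$, then there are constants $0<C_1<C_2$, possibly depending on the sequence $(F_n)$ but not on $n$, such that for all $n\ge1$ $$C_1\operatorname{Var}\bigl(\Gamma_1(F_n)-2F_n\bigr)^2\le \operatorname{Var}\bigl(\Gamma_3(F_n)-2\Gamma_2(F_n)\bigr)\le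 C_2\operatorname{Var}\bigl(\Gamma_1(F_n)-2F_n\bigr)^2.$$ -/

import Mathlib

open MeasureTheory ProbabilityTheory Filter Topology Asymptotics
open scoped ENNReal RealInnerProductSpace

namespace GammaChaos

noncomputable section

/-- `X = {X(h) : h ∈ H}` is an isonormal Gaussian process over the Hilbert space `H`: a centered,
jointly Gaussian family with covariance `E[X(g) X(h)] = ⟪g, h⟫`. -/
structure IsIsonormal {H Ω : Type*} [NormedAddCommGroup H] [InnerProductSpace ℝ H]
    [MeasurableSpace Ω] (X : H → Ω → ℝ) (P : Measure Ω) : Prop where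
  isGaussianProcess : IsGaussianProcess X P
  centered : ∀ h : H, ∫ ω, X h ω ∂P = 0
  covariance : ∀ g h : H, ∫ ω, X g ω * X h ω ∂P = ⟪g, h⟫

/-- The `q`-th Wiener chaos of `X`: the closed linear subspace of `L²(Ω)` generated by the random
variables `H_q(X(h))` with `‖h‖ = 1`, where `H_q` is the (probabilists') Hermite polynomial.
For `q = 0` these are the constants. -/
def wienerChaos {H Ω : Type*} [NormedAddCommGroup H] [InnerProductSpace ℝ H]
    [MeasurableSpace Ω] (X : H → Ω → ℝ) (P : Measure Ω) (q : ℕ) : Submodule ℝ (Lp ℝ 2 P) :=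
  (Submodule.span ℝ {f : Lp ℝ 2 P | ∃ h : H, (q ≠ 0 → ‖h‖ = 1) ∧
    (f : Ω → ℝ) =ᵐ[P] fun ω => Polynomial.aeval (X h ω) (Polynomial.hermite q)}).topologicalClosure

instance wienerChaos_hasOrthogonalProjection {H Ω : Type*} [NormedAddCommGroup H]
    [InnerProductSpace ℝ H] [MeasurableSpace Ω] (X : H → Ω → ℝ) (P : Measure Ω) (q : ℕ) :
    (wienerChaos X P q).HasOrthogonalProjection := by
  have : CompleteSpace (wienerChaos X P q) :=
    (Submodule.isClosed_topologicalClosure _).completeSpace_coe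
  exact Submodule.HasOrthogonalProjection.ofCompleteSpace _

/-- The pseudo-inverse `L⁻¹ F = -∑_{p ≥ 1} (1/p) J_p F` of the generator of the Ornstein-Uhlenbeck
semigroup, where `J_p` is the orthogonal projection of `L²(Ω)` onto the `p`-th Wiener chaos
(the summation index below is `p - 1`). The value is `0` when `F` is not square integrable. -/
def pseudoInverse {H Ω : Type*} [NormedAddCommGroup H] [InnerProductSpace ℝ H]
    [MeasurableSpace Ω] (X : H → Ω → ℝ) (P : Measure Ω) (F : Ω → ℝ) : Ω → ℝ :=
  open Classical in
  if hF : MemLp F 2 P then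
    ((-∑' p : ℕ, ((p : ℝ) + 1)⁻¹ • (wienerChaos X P (p + 1)).starProjection (hF.toLp F) :
      Lp ℝ 2 P) : Ω → ℝ)
  else 0

/-- The graph of the Malliavin derivative on smooth random variables: the pairs `(F, DF)` with
`F = g(X(φ₁), …, X(φ_m))` and `DF = ∑ i, ∂ᵢg(X(φ₁), …, X(φ_m)) φᵢ`, where `g` is `C^∞` and `g` and
all its partial derivatives have at most polynomial growth. -/
def smoothGraph {H Ω : Type*} [NormedAddCommGroup H] [InnerProductSpace ℝ H]
    [MeasurableSpace Ω] (X : H → Ω → ℝ) (P : Measure Ω) : Set (Lp ℝ 2 P × Lp H 2 P) :=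
  {p | ∃ (m : ℕ) (φ : Fin m → H) (g : (Fin m → ℝ) → ℝ), g.HasTemperateGrowth ∧
    (p.1 : Ω → ℝ) =ᵐ[P] (fun ω => g (fun i => X (φ i) ω)) ∧
    (p.2 : Ω → H) =ᵐ[P]
      (fun ω => ∑ i, (fderiv ℝ g (fun j => X (φ j) ω) (Pi.single i 1)) • φ i)}

/-- `F ∈ 𝔻^{1,2}` and `u` is a version of its Malliavin derivative: `(F, u)` lies in the closure,
in `L²(Ω) × L²(Ω; H)`, of the graph of the derivative on smooth random variables. -/
def IsMalliavinDeriv {H Ω : Type*} [NormedAddCommGroup H] [InnerProductSpace ℝ H]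
    [MeasurableSpace Ω] (X : H → Ω → ℝ) (P : Measure Ω) (F : Ω → ℝ) (u : Ω → H) : Prop :=
  ∃ (hF : MemLp F 2 P) (hu : MemLp u 2 P), (hF.toLp F, hu.toLp u) ∈ closure (smoothGraph X P)

/-- The Malliavin derivative `DF` of `F ∈ 𝔻^{1,2}` (and `0` if `F ∉ 𝔻^{1,2}`). -/
def malliavinDeriv {H Ω : Type*} [NormedAddCommGroup H] [InnerProductSpace ℝ H]
    [MeasurableSpace Ω] (X : H → Ω → ℝ) (P : Measure Ω) (F : Ω → ℝ) : Ω → H :=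
  open Classical in
  if h : ∃ u : Ω → H, IsMalliavinDeriv X P F u then h.choose else 0

/-- The iterated Gamma operators: `Γ₀(F) = F` and `Γ_{r+1}(F) = ⟪D Γ_r(F), -D L⁻¹ F⟫`. -/
def gammaOp {H Ω : Type*} [NormedAddCommGroup H] [InnerProductSpace ℝ H]
    [MeasurableSpace Ω] (X : H → Ω → ℝ) (P : Measure Ω) : ℕ → (Ω → ℝ) → Ω → ℝ
  | 0, F => F
  | r + 1, F => fun ω =>
      ⟪malliavinDeriv X P (gammaOp X P r F) ω, -malliavinDeriv X P (pseudoInverse X P F) ω⟫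

/-- `CenteredGamma(ν)`: the law of `2 Ĝ - ν`, where `Ĝ` has the Gamma law with shape `ν / 2` and
rate `1`. -/
def centeredGamma (ν : ℝ) : Measure ℝ :=
  (gammaMeasure (ν / 2) 1).map (fun x => 2 * x - ν)

/-- `max {|1 - c_i| : i among the first d indices}`; the indices start at `0`. -/
def omegaRate (c : ℕ → ℝ) (d : ℕ) : ℝ := ⨆ i : Fin d, |1 - c i|

/-- The sum of `c_i ^ 2` over all but the first `d` indices; the indices start at `0`. -/
def thetaRate (c : ℕ → ℝ) (d : ℕ) : ℝ := ∑' i : ℕ, c (d + i) ^ 2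

end

end GammaChaos

/-! On the second chaos every object is explicit in the coefficients. If `F = ∑ c_i (N_i² - 1)`,
then `DF = ∑ 2 c_i N_i e_i` and `L⁻¹F = -F/2`, hence `Γ_r(F) = const + 2^r ∑ c_i^(r+1) (N_i² - 1)`
and `Var(Γ_{r+1} - 2Γ_r) = 8·4^r ∑ c_i^(2r+2) (c_i - 1)²` (`IsChaosCoeff.variance_gammaOp_eq`). The
theorem thus compares `V = 8 ∑ c²(c-1)²` with `W = 128 ∑ c⁶(c-1)²`. Since `malliavinDeriv` is a
chosen element of a closure, the explicit formula for `D` requires closability, which follows from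
Gaussian integration by parts (`IsIsonormal.closure_smoothGraph_unique`).

Convergence in law enters only through third and fourth moments: sixth moments on the second chaos
are bounded by the variance, so these moments converge, and comparison with the Gamma moments gives
`∑ c³ → ν` and `∑ c⁴ → ν` (`tendsto_powerSums`). As `∑ c² = ν`, this yields `∑ c²(c-1)² → 0`. Every
coefficient is then close to 0 or 1 in a quantitative sense, the number of those close to 1
converges to `ν`, and so `ν` is an integer `d` (`exists_nat_eq_of_tendsto`).

From there `ω, ϑ → 0`, `ϑ ≲ V ≲ ω² + ϑ` and `ω² ≲ W ≲ ω² + ϑ³`, while the variance constraint forces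
`ϑ = O(ω)`. So `W ≈ V²` amounts to `ω ≈ ω² + ϑ`, that is, to `ω ≈ ϑ` (`isTheta_iff_of_rates`). The
bounds extend to all `n` because `V` and `W` vanish simultaneously, namely when every coefficient is
0 or 1. -/

namespace GammaChaos

set_option linter.unusedSectionVars false

/-! ### Stein's identity on the real line. -/

section OneDimensional

theorem hasDerivAt_gaussianPDFReal_zero (v : NNReal) (x : ℝ) :
    HasDerivAt (gaussianPDFReal 0 v) (-(x / v) * gaussianPDFReal 0 v x) x := by
  have h : HasDerivAt (fun y : ℝ => -(y - 0) ^ 2 / (2 * (v : ℝ))) (-(x / v)) x := by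
    have := (((hasDerivAt_id x).sub_const 0).pow 2).neg.div_const (2 * (v : ℝ))
    convert! this using 1
    by_cases hv : (v : ℝ) = 0
    · simp [hv]
    · simp; field_simp
  have := (h.exp).const_mul (√(2 * Real.pi * v))⁻¹
  rw [gaussianPDFReal_def]
  convert! this using 1
  ring

theorem integrable_gaussianReal_iff {v : NNReal} (hv : v ≠ 0) (f : ℝ → ℝ) :
    Integrable f (gaussianReal 0 v) ↔ Integrable (fun x => gaussianPDFReal 0 v x * f x) := by
  rw [gaussianReal_of_var_ne_zero _ hv,
    integrable_withDensity_iff_integrable_smul' (measurable_gaussianPDF 0 v)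
      (ae_of_all _ fun _ => gaussianPDF_lt_top)]
  simp [toReal_gaussianPDF]

/-- Stein's identity for a centered Gaussian law on the line. -/
theorem integral_id_mul_gaussianReal {v : NNReal} (hv : v ≠ 0) {f f' : ℝ → ℝ}
    (hf : ∀ x, HasDerivAt f (f' x) x) (h0 : Integrable f (gaussianReal 0 v))
    (h1 : Integrable (fun x => x * f x) (gaussianReal 0 v))
    (h2 : Integrable f' (gaussianReal 0 v)) :
    ∫ x, x * f x ∂(gaussianReal 0 v) = v * ∫ x, f' x ∂(gaussianReal 0 v) := by
  have hv' : (v : ℝ) ≠ 0 := by exact_mod_cast hv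
  rw [integrable_gaussianReal_iff hv] at h0 h1 h2
  rw [integral_gaussianReal_eq_integral_smul hv, integral_gaussianReal_eq_integral_smul hv]
  -- With `ρ` the Gaussian density, `-v ρ` is a primitive of `x ρ`; the integrability hypotheses
  -- make the boundary terms vanish.
  have key := integral_mul_deriv_eq_deriv_mul_of_integrable (u := f) (u' := f')
    (v := fun x => -(v * gaussianPDFReal 0 v x)) (v' := fun x => x * gaussianPDFReal 0 v x)
    (fun x _ => hf x)
    (fun x _ => by
      have := ((hasDerivAt_gaussianPDFReal_zero v x).const_mul (v : ℝ)).neg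
      convert! this using 1
      field_simp)
    (by
      convert! h1 using 1
      ext x; simp only [Pi.mul_apply]; ring)
    (by
      convert! h2.const_mul (-v : ℝ) using 1
      ext x; simp only [Pi.mul_apply]; ring)
    (by
      convert! h0.const_mul (-v : ℝ) using 1
      ext x; simp only [Pi.mul_apply]; ring)
  simp only [smul_eq_mul]
  calc _ = ∫ x, f x * (x * gaussianPDFReal 0 v x) := by congr 1; ext x; ring
    _ = _ := by
      rw [key, ← integral_neg, ← integral_const_mul]
      congr 1; ext x; ring

end OneDimensional

/-! ### Integrability of functions of polynomial growth. -/

section PolynomialGrowth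

variable {Ω E : Type*} [MeasurableSpace Ω] {P : Measure Ω} [IsProbabilityMeasure P]
  [NormedAddCommGroup E]

theorem memLp_one_add_norm_pow {Φ : Ω → E} (hΦ : ∀ p : ℝ≥0∞, p ≠ ∞ → MemLp Φ p P) (k : ℕ)
    {p : ℝ≥0∞} (hp : p ≠ ∞) : MemLp (fun ω => (1 + ‖Φ ω‖) ^ k) p P := by
  rcases Nat.eq_zero_or_pos k with hk | hk
  · simp only [hk, pow_zero]
    exact memLp_const 1
  have h : MemLp (fun ω => 1 + ‖Φ ω‖) (p * k) P :=
    MemLp.add (memLp_const (1 : ℝ)) (hΦ _ (ENNReal.mul_ne_top hp (by simp))).norm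
  have := h.norm_rpow_div (k : ℝ≥0∞)
  rw [ENNReal.mul_div_cancel_right (by simpa using hk.ne') (by simp)] at this
  have e : (fun ω => (1 + ‖Φ ω‖) ^ k) = fun ω => ‖1 + ‖Φ ω‖‖ ^ ((k : ℝ≥0∞)).toReal := by
    ext ω
    have h1 : 0 ≤ 1 + ‖Φ ω‖ := by positivity
    rw [Real.norm_of_nonneg h1, ENNReal.toReal_natCast, Real.rpow_natCast]
  rw [e]
  exact this

theorem memLp_of_norm_le_pow {G : Type*} [NormedAddCommGroup G] {Φ : Ω → E}
    (hΦ : ∀ p : ℝ≥0∞, p ≠ ∞ → MemLp Φ p P) {g : Ω → G} (hg : AEStronglyMeasurable g P)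
    {C : ℝ} {k : ℕ} (h : ∀ ω, ‖g ω‖ ≤ C * (1 + ‖Φ ω‖) ^ k) {p : ℝ≥0∞} (hp : p ≠ ∞) :
    MemLp g p P := by
  refine ((memLp_one_add_norm_pow hΦ k hp).const_mul C).of_le hg (ae_of_all _ fun ω => ?_)
  exact (h ω).trans (le_abs_self _)

theorem _root_.Function.HasTemperateGrowth.exists_bound {E F : Type*} [NormedAddCommGroup E]
    [NormedSpace ℝ E] [NormedAddCommGroup F] [NormedSpace ℝ F] {g : E → F}
    (hg : g.HasTemperateGrowth) : ∃ (k : ℕ) (C : ℝ), 0 ≤ C ∧ (∀ x, ‖g x‖ ≤ C * (1 + ‖x‖) ^ k) ∧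
      ∀ x, ‖fderiv ℝ g x‖ ≤ C * (1 + ‖x‖) ^ k := by
  obtain ⟨k, C, hC, h⟩ := hg.norm_iteratedFDeriv_le_uniform 1
  exact ⟨k, C, hC, fun x => by simpa using h 0 (by norm_num) x,
    fun x => by simpa [norm_iteratedFDeriv_one] using h 1 le_rfl x⟩

/-- The product is a function of quadratic growth of the pair `(f, g)`, which has all moments. -/
theorem MemLp.mul_of_forall {f g : Ω → ℝ} (hf : ∀ p : ℝ≥0∞, p ≠ ∞ → MemLp f p P)
    (hg : ∀ p : ℝ≥0∞, p ≠ ∞ → MemLp g p P) {p : ℝ≥0∞} (hp : p ≠ ∞) :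
    MemLp (fun ω => f ω * g ω) p P := by
  have h := memLp_of_norm_le_pow (E := ℝ × ℝ) (Φ := fun ω => (f ω, g ω)) (g := fun ω => f ω * g ω)
    (P := P) (C := 1) (k := 2) (fun q hq => memLp_prod_iff.2 ⟨hf q hq, hg q hq⟩) ?_ ?_ hp
  · exact h
  · have h1 := (hf 1 (by simp)).1
    have h2 := (hg 1 (by simp)).1
    exact h1.mul h2
  · intro ω
    have h1 : ‖f ω‖ ≤ ‖(f ω, g ω)‖ := norm_fst_le (f ω, g ω)
    have h2 : ‖g ω‖ ≤ ‖(f ω, g ω)‖ := norm_snd_le (f ω, g ω)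
    rw [norm_mul, one_mul]
    nlinarith [norm_nonneg (f ω), norm_nonneg (g ω), norm_nonneg (f ω, g ω)]

end PolynomialGrowth

/-! ### Isonormal processes: almost sure linearity and Gaussian integration by parts. -/

section Isonormal

variable {H Ω : Type*} [NormedAddCommGroup H] [InnerProductSpace ℝ H] [MeasurableSpace Ω]
  {P : Measure Ω} [IsProbabilityMeasure P] {X : H → Ω → ℝ}

theorem IsIsonormal.memLp (hX : IsIsonormal X P) (h : H) {p : ℝ≥0∞} (hp : p ≠ ∞) :
    MemLp (X h) p P :=
  (hX.isGaussianProcess.hasGaussianLaw_eval h).memLp hp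

theorem IsIsonormal.aemeasurable (hX : IsIsonormal X P) (h : H) : AEMeasurable (X h) P :=
  hX.isGaussianProcess.aemeasurable h

theorem IsIsonormal.memLp_pi (hX : IsIsonormal X P) {ι : Type*} [Fintype ι] (φ : ι → H)
    {p : ℝ≥0∞} (hp : p ≠ ∞) : MemLp (fun ω i => X (φ i) ω) p P :=
  MemLp.of_eval fun i => hX.memLp (φ i) hp

theorem IsIsonormal.aemeasurable_pi (hX : IsIsonormal X P) {ι : Type*} [Fintype ι] (φ : ι → H) :
    AEMeasurable (fun ω i => X (φ i) ω) P :=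
  aemeasurable_pi_lambda _ fun i => hX.aemeasurable (φ i)

theorem IsIsonormal.integrable_mul (hX : IsIsonormal X P) (g h : H) :
    Integrable (fun ω => X g ω * X h ω) P :=
  (hX.memLp g (p := 2) (by simp)).integrable_mul (hX.memLp h (p := 2) (by simp))

theorem IsIsonormal.cov (hX : IsIsonormal X P) (g h : H) : cov[X g, X h; P] = ⟪g, h⟫ := by
  rw [covariance_eq_sub (hX.memLp g (by simp)) (hX.memLp h (by simp)), hX.centered g,
    zero_mul, sub_zero]
  exact hX.covariance g h

theorem IsIsonormal.map_eq (hX : IsIsonormal X P) (h : H) :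
    P.map (X h) = gaussianReal 0 (‖h‖₊ ^ 2) := by
  rw [(hX.isGaussianProcess.hasGaussianLaw_eval h).map_eq_gaussianReal, hX.centered h]
  congr 1
  rw [← covariance_self (hX.aemeasurable h), hX.cov, real_inner_self_eq_norm_sq]
  ext; simp

/-- Linearity of `X` is not part of the definition; the covariance forces it, since the second
moment of the difference expands to zero. -/
theorem IsIsonormal.ae_eq_sub_smul (hX : IsIsonormal X P) (g h : H) (a : ℝ) :
    X (g - a • h) =ᵐ[P] fun ω => X g ω - a * X h ω := by
  have hint : Integrable (fun ω => (X (g - a • h) ω - (X g ω - a * X h ω)) ^ 2) P :=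
    ((hX.memLp _ (by simp)).sub ((hX.memLp g (by simp)).sub
      ((hX.memLp h (by simp)).const_mul a))).integrable_sq
  have h0 : ∫ ω, (X (g - a • h) ω - (X g ω - a * X h ω)) ^ 2 ∂P = 0 := by
    have e : (fun ω => (X (g - a • h) ω - (X g ω - a * X h ω)) ^ 2) = fun ω =>
        X (g - a • h) ω * X (g - a • h) ω + X g ω * X g ω + a ^ 2 * (X h ω * X h ω)
        + (-2) * (X (g - a • h) ω * X g ω) + (2 * a) * (X (g - a • h) ω * X h ω)
        + (-(2 * a)) * (X g ω * X h ω) := by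
      ext ω; ring
    have i1 := hX.integrable_mul
    rw [e, integral_add (by fun_prop) (by fun_prop), integral_add (by fun_prop) (by fun_prop),
      integral_add (by fun_prop) (by fun_prop), integral_add (by fun_prop) (by fun_prop),
      integral_add (by fun_prop) (by fun_prop)]
    simp only [integral_const_mul, hX.covariance, inner_sub_left, inner_sub_right,
      real_inner_smul_left, real_inner_smul_right, real_inner_comm g h]
    ring
  rw [integral_eq_zero_iff_of_nonneg (fun ω => by positivity) hint] at h0
  filter_upwards [h0] with ω hω
  have := pow_eq_zero_iff (two_ne_zero) |>.1 hω
  linarith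

theorem IsIsonormal.zero_ae (hX : IsIsonormal X P) : X 0 =ᵐ[P] 0 := by
  filter_upwards [hX.ae_eq_sub_smul 0 0 1] with ω hω
  simpa using hω

theorem IsIsonormal.memLp_comp (hX : IsIsonormal X P) {ι G : Type*} [Fintype ι]
    [NormedAddCommGroup G] (φ : ι → H) {g : (ι → ℝ) → G} (hg : Continuous g)
    {C : ℝ} {k : ℕ} (h : ∀ x, ‖g x‖ ≤ C * (1 + ‖x‖) ^ k) {p : ℝ≥0∞} (hp : p ≠ ∞) :
    MemLp (fun ω => g (fun i => X (φ i) ω)) p P :=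
  memLp_of_norm_le_pow (fun _ hq => hX.memLp_pi φ hq)
    (hg.comp_aestronglyMeasurable (hX.aemeasurable_pi φ).aestronglyMeasurable) (fun _ => h _) hp

/-- Gaussian integration by parts: `E[X(h) g(X(φ))] = E[∂_a g(X(φ))]` where `a i = ⟪φ i, h⟫`. -/
theorem IsIsonormal.integral_mul_comp (hX : IsIsonormal X P) {ι : Type*} [Fintype ι] (h : H)
    (φ : ι → H) {g : (ι → ℝ) → ℝ} (hg : g.HasTemperateGrowth) :
    ∫ ω, X h ω * g (fun i => X (φ i) ω) ∂P
      = ∫ ω, fderiv ℝ g (fun i => X (φ i) ω) (fun i => ⟪φ i, h⟫) ∂P := by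
  by_cases hh : h = 0
  · subst hh
    have e : (fun i => ⟪φ i, (0 : H)⟫) = 0 := by ext; simp
    rw [e]
    simp only [map_zero, integral_zero]
    rw [integral_congr_ae (g := fun _ => 0)]
    · simp
    · filter_upwards [hX.zero_ae] with ω hω
      simp [hω]
  have hn : ‖h‖ ≠ 0 := by simpa using hh
  obtain ⟨k, C, hC, hg0, hg1⟩ := hg.exists_bound
  set v : NNReal := ‖h‖₊ ^ 2 with hv
  have hv0 : v ≠ 0 := by simpa [hv] using hh
  have hvr : (v : ℝ) = ‖h‖ ^ 2 := by simp [hv]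
  -- Regression coefficients: `φ i - a i • h` is orthogonal to `h`, so the residuals `Y` are
  -- independent of `X h`. Freezing `Y` reduces the claim to Stein's identity in the single variable
  -- `X h`, along the line `y + z • a`.
  set a : ι → ℝ := fun i => ⟪φ i, h⟫ / ‖h‖ ^ 2 with ha
  set Y : ι → Ω → ℝ := fun i => X (φ i - a i • h) with hY
  set γ := gaussianReal 0 v
  have mY : AEMeasurable (fun ω i => Y i ω) P := hX.aemeasurable_pi _
  have mZ := hX.aemeasurable h
  have hind : IndepFun (fun ω i => Y i ω) (X h) P := by
    have h1 : IndepFun (fun ω i => Y i ω) (fun ω (_ : Unit) => X h ω) P := by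
      refine IsGaussianProcess.indepFun_of_covariance_eq_zero (X := Y) (Y := fun _ => X h) ?_
        (fun i => hX.aemeasurable _) (fun _ => mZ) ?_
      · have := hX.isGaussianProcess.comp_right
          (Sum.elim (fun i => φ i - a i • h) (fun _ : Unit => h))
        convert! this using 1
        ext (i | i) <;> rfl
      · intro i _
        simp only [hY]
        rw [hX.cov, inner_sub_left, real_inner_smul_left, real_inner_self_eq_norm_sq]
        simp only [ha]
        field_simp
        ring
    exact h1.comp measurable_id (measurable_pi_apply ())
  set μ := P.map (fun ω i => Y i ω)
  have : IsProbabilityMeasure μ := Measure.isProbabilityMeasure_map mY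
  have hlaw : P.map (fun ω => ((fun i => Y i ω), X h ω)) = μ.prod γ := by
    rw [(indepFun_iff_map_prod_eq_prod_map_map mY mZ).1 hind, hX.map_eq h]
  have hφ : ∀ᵐ ω ∂P, (fun i => X (φ i) ω) = (fun i => Y i ω) + X h ω • a := by
    have : ∀ᵐ ω ∂P, ∀ i, Y i ω = X (φ i) ω - a i * X h ω :=
      ae_all_iff.2 fun i => hX.ae_eq_sub_smul (φ i) h (a i)
    filter_upwards [this] with ω hω
    ext i
    simp [hω i]; ring
  have hgc : Continuous g := hg.1.continuous
  have hgd : Differentiable ℝ g := hg.1.differentiable (by simp)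
  have hgdc : Continuous (fderiv ℝ g) := hg.1.continuous_fderiv (by simp)
  have cc : Continuous (fun q : (ι → ℝ) × ℝ => q.1 + q.2 • a) := by fun_prop
  have m2 : AEMeasurable (fun ω => ((fun i => Y i ω), X h ω)) P := mY.prodMk mZ
  have tr : ∀ f : (ι → ℝ) × ℝ → ℝ, Continuous f →
      ∫ ω, f ((fun i => Y i ω), X h ω) ∂P = ∫ q, f q ∂(μ.prod γ) := fun f hf => by
    rw [← hlaw, integral_map m2 hf.aestronglyMeasurable]
  have tri : ∀ f : (ι → ℝ) × ℝ → ℝ, Continuous f →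
      Integrable (fun ω => f ((fun i => Y i ω), X h ω)) P → Integrable f (μ.prod γ) :=
    fun f hf hi => by
      rw [← hlaw]
      exact (integrable_map_measure hf.aestronglyMeasurable m2).2 hi
  have I0 : Integrable (fun ω => g (fun i => X (φ i) ω)) P :=
    (hX.memLp_comp φ hgc hg0 (p := 1) (by simp)).integrable le_rfl
  have I1 : Integrable (fun ω => X h ω * g (fun i => X (φ i) ω)) P :=
    (hX.memLp h (p := 2) (by simp)).integrable_mul (hX.memLp_comp φ hgc hg0 (p := 2) (by simp))
  have I2 : Integrable (fun ω => fderiv ℝ g (fun i => X (φ i) ω) a) P := by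
    refine (hX.memLp_comp φ (g := fun x => fderiv ℝ g x a) (C := C * ‖a‖) (k := k) (by fun_prop)
      (fun x => ?_) (p := 1) (by simp)).integrable le_rfl
    calc _ ≤ ‖fderiv ℝ g x‖ * ‖a‖ := ContinuousLinearMap.le_opNorm _ _
      _ ≤ C * (1 + ‖x‖) ^ k * ‖a‖ := by gcongr; exact hg1 x
      _ = _ := by ring
  have J0 := tri (fun q => g (q.1 + q.2 • a)) (by fun_prop) (I0.congr (by
    filter_upwards [hφ] with ω hω; rw [hω]))
  have J1 := tri (fun q => q.2 * g (q.1 + q.2 • a)) (by fun_prop) (I1.congr (by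
    filter_upwards [hφ] with ω hω; rw [hω]))
  have J2 := tri (fun q => fderiv ℝ g (q.1 + q.2 • a) a) (by fun_prop) (I2.congr (by
    filter_upwards [hφ] with ω hω; rw [hω]))
  have hav : (fun i => ⟪φ i, h⟫) = (v : ℝ) • a := by
    ext i
    simp only [ha, Pi.smul_apply, smul_eq_mul, hvr]
    field_simp
  calc _ = ∫ ω, (fun q : (ι → ℝ) × ℝ => q.2 * g (q.1 + q.2 • a)) ((fun i => Y i ω), X h ω) ∂P := by
        refine integral_congr_ae ?_
        filter_upwards [hφ] with ω hω
        rw [hω]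
    _ = ∫ y, ∫ z, z * g (y + z • a) ∂γ ∂μ := by
        rw [tr (fun q => q.2 * g (q.1 + q.2 • a)) (by fun_prop), integral_prod _ J1]
    _ = ∫ y, v * ∫ z, fderiv ℝ g (y + z • a) a ∂γ ∂μ := by
        refine integral_congr_ae ?_
        filter_upwards [J0.prod_right_ae, J1.prod_right_ae, J2.prod_right_ae] with y h0 h1 h2
        refine integral_id_mul_gaussianReal hv0 (f := fun z => g (y + z • a))
          (f' := fun z => fderiv ℝ g (y + z • a) a) (fun z => ?_) h0 h1 h2
        have hl : HasDerivAt (fun z : ℝ => y + z • a) a z := by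
          simpa using ((hasDerivAt_id z).smul_const a).const_add y
        exact (hgd (y + z • a)).hasFDerivAt.comp_hasDerivAt z hl
    _ = v * ∫ ω, (fun q : (ι → ℝ) × ℝ => fderiv ℝ g (q.1 + q.2 • a) a)
          ((fun i => Y i ω), X h ω) ∂P := by
        rw [integral_const_mul, tr (fun q => fderiv ℝ g (q.1 + q.2 • a) a) (by fun_prop),
          integral_prod _ J2]
    _ = _ := by
        rw [← integral_const_mul, hav]
        refine integral_congr_ae ?_
        filter_upwards [hφ] with ω hω
        rw [hω, map_smul, smul_eq_mul]

end Isonormal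

/-! ### Closability of the Malliavin derivative. -/

section Closability

theorem _root_.Function.HasTemperateGrowth.fderiv_apply {E : Type*} [NormedAddCommGroup E]
    [NormedSpace ℝ E] {g : E → ℝ} (hg : g.HasTemperateGrowth) (a : E) :
    (fun x => fderiv ℝ g x a).HasTemperateGrowth := by
  have h1 : (fderiv ℝ g).HasTemperateGrowth := by
    refine ⟨hg.1.fderiv_right (by simp), fun n => ?_⟩
    obtain ⟨k, C, h⟩ := hg.2 (n + 1)
    exact ⟨k, C, fun x => by rw [norm_iteratedFDeriv_fderiv]; exact h x⟩
  exact (ContinuousLinearMap.apply ℝ ℝ a).hasTemperateGrowth.comp h1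

variable {H Ω : Type*} [NormedAddCommGroup H] [InnerProductSpace ℝ H] [MeasurableSpace Ω]
  {P : Measure Ω} [IsProbabilityMeasure P] {X : H → Ω → ℝ}

theorem IsIsonormal.memLp_smooth (hX : IsIsonormal X P) {ι : Type*} [Fintype ι] (φ : ι → H)
    {g : (ι → ℝ) → ℝ} (hg : g.HasTemperateGrowth) {p : ℝ≥0∞} (hp : p ≠ ∞) :
    MemLp (fun ω => g (fun i => X (φ i) ω)) p P := by
  obtain ⟨k, C, hC, hg0, hg1⟩ := hg.exists_bound
  exact hX.memLp_comp φ hg.1.continuous hg0 hp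

theorem IsIsonormal.memLp_smooth_deriv (hX : IsIsonormal X P) {m : ℕ} (φ : Fin m → H)
    {g : (Fin m → ℝ) → ℝ} (hg : g.HasTemperateGrowth) {p : ℝ≥0∞} (hp : p ≠ ∞) :
    MemLp (fun ω => ∑ i, (fderiv ℝ g (fun j => X (φ j) ω) (Pi.single i 1)) • φ i) p P := by
  refine memLp_finsetSum _ fun i _ => ?_
  have h1 : MemLp (fun ω => fderiv ℝ g (fun j => X (φ j) ω) (Pi.single i 1)) p P :=
    hX.memLp_smooth φ (hg.fderiv_apply (Pi.single i 1)) hp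
  refine (h1.norm.mul_const ‖φ i‖).of_le
    (h1.1.smul_const _) (ae_of_all _ fun ω => ?_)
  rw [norm_smul]
  exact le_abs_self _

theorem IsIsonormal.exists_mem_smoothGraph (hX : IsIsonormal X P) {m : ℕ} (φ : Fin m → H)
    {g : (Fin m → ℝ) → ℝ} (hg : g.HasTemperateGrowth) :
    ((hX.memLp_smooth φ hg (p := 2) (by simp)).toLp (fun ω => g (fun i => X (φ i) ω)),
      (hX.memLp_smooth_deriv φ hg (p := 2) (by simp)).toLp (fun ω =>
        ∑ i, (fderiv ℝ g (fun j => X (φ j) ω) (Pi.single i 1)) • φ i)) ∈ smoothGraph X P :=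
  ⟨m, φ, g, hg, (hX.memLp_smooth φ hg (by simp)).coeFn_toLp,
    (hX.memLp_smooth_deriv φ hg (by simp)).coeFn_toLp⟩

theorem fderiv_inner_eq {m : ℕ} (φ : Fin m → H) (g : (Fin m → ℝ) → ℝ) (x : Fin m → ℝ) (h : H) :
    ⟪h, ∑ i, (fderiv ℝ g x (Pi.single i 1)) • φ i⟫ = fderiv ℝ g x (fun i => ⟪φ i, h⟫) := by
  rw [inner_sum]
  have : (fun i => ⟪φ i, h⟫) = ∑ i, ⟪φ i, h⟫ • (Pi.single i 1 : Fin m → ℝ) := by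
    ext j; simp [Finset.sum_apply, Pi.single_apply]
  rw [this, map_sum]
  refine Finset.sum_congr rfl fun i _ => ?_
  rw [map_smul, inner_smul_right, real_inner_comm, smul_eq_mul, mul_comm]

/-- The scalar product with `h`, as a map on `L²`. -/
noncomputable def innerLp (P : Measure Ω) (h : H) : Lp H 2 P →L[ℝ] Lp ℝ 2 P :=
  (innerSL ℝ h).compLpL 2 P

theorem innerLp_coeFn (h : H) (u : Lp H 2 P) : innerLp P h u =ᵐ[P] fun ω => ⟪h, u ω⟫ :=
  (innerSL ℝ h).coeFn_compLpL u

theorem inner_Lp_eq_integral (f g : Lp ℝ 2 P) : ⟪f, g⟫ = ∫ ω, f ω * g ω ∂P := by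
  rw [L2.inner_def]
  refine integral_congr_ae (ae_of_all _ fun ω => ?_)
  simp [mul_comm]

/-- For smooth `G` the witness is the divergence of `G h`, that is `R = X(h) G - ⟪DG, h⟫`. The
identity is integration by parts applied to the product of two smooth variables. -/
theorem IsIsonormal.exists_adjoint_smooth (hX : IsIsonormal X P) (h : H) {q : Lp ℝ 2 P × Lp H 2 P}
    (hq : q ∈ smoothGraph X P) :
    ∃ R : Lp ℝ 2 P, ∀ p ∈ smoothGraph X P, ⟪innerLp P h p.2, q.1⟫ = ⟪p.1, R⟫ := by
  obtain ⟨k, ψ, γ, hγ, hq1, hq2⟩ := hq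
  have mR : MemLp (fun ω => X h ω * γ (fun i => X (ψ i) ω)
      - fderiv ℝ γ (fun i => X (ψ i) ω) (fun i => ⟪ψ i, h⟫)) 2 P :=
    (MemLp.mul_of_forall (fun p hp => hX.memLp h hp) (fun p hp => hX.memLp_smooth ψ hγ hp)
      (by simp)).sub (hX.memLp_smooth ψ (hγ.fderiv_apply _) (by simp))
  refine ⟨mR.toLp _, ?_⟩
  rintro p ⟨m, φ, g, hg, hp1, hp2⟩
  -- The two smooth variables depend on different Gaussian vectors; they are pulled back to the
  -- concatenated vector so that their product is again smooth.
  let l1 : (Fin m ⊕ Fin k → ℝ) →L[ℝ] (Fin m → ℝ) :=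
    ContinuousLinearMap.pi fun i => ContinuousLinearMap.proj (Sum.inl i)
  let l2 : (Fin m ⊕ Fin k → ℝ) →L[ℝ] (Fin k → ℝ) :=
    ContinuousLinearMap.pi fun i => ContinuousLinearMap.proj (Sum.inr i)
  have hG1 : (fun x => g (l1 x)).HasTemperateGrowth := hg.comp l1.hasTemperateGrowth
  have hG2 : (fun x => γ (l2 x)).HasTemperateGrowth := hγ.comp l2.hasTemperateGrowth
  have key := hX.integral_mul_comp h (Sum.elim φ ψ) (hG1.mul hG2)
  have dg : Differentiable ℝ g := hg.1.differentiable (by simp)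
  have dγ : Differentiable ℝ γ := hγ.1.differentiable (by simp)
  have hfd : ∀ x a, fderiv ℝ ((fun x => g (l1 x)) * fun x => γ (l2 x)) x a
      = g (l1 x) * fderiv ℝ γ (l2 x) (l2 a) + γ (l2 x) * fderiv ℝ g (l1 x) (l1 a) := by
    intro x a
    have e1 : HasFDerivAt (fun x => g (l1 x)) ((fderiv ℝ g (l1 x)).comp l1) x :=
      (dg (l1 x)).hasFDerivAt.comp x l1.hasFDerivAt
    have e2 : HasFDerivAt (fun x => γ (l2 x)) ((fderiv ℝ γ (l2 x)).comp l2) x :=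
      (dγ (l2 x)).hasFDerivAt.comp x l2.hasFDerivAt
    rw [(e1.mul e2).fderiv]
    simp
  simp only [hfd, Pi.mul_apply] at key
  have c1 : ∀ ω, l1 (fun i => X (Sum.elim φ ψ i) ω) = fun i => X (φ i) ω := fun ω => rfl
  have c2 : ∀ ω, l2 (fun i => X (Sum.elim φ ψ i) ω) = fun i => X (ψ i) ω := fun ω => rfl
  have c3 : l1 (fun i => ⟪Sum.elim φ ψ i, h⟫) = fun i => ⟪φ i, h⟫ := rfl
  have c4 : l2 (fun i => ⟪Sum.elim φ ψ i, h⟫) = fun i => ⟪ψ i, h⟫ := rfl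
  simp only [c1, c2, c3, c4] at key
  have m1 : ∀ p : ℝ≥0∞, p ≠ ∞ → MemLp (fun ω => g (fun i => X (φ i) ω)) p P :=
    fun p hp => hX.memLp_smooth φ hg hp
  have m2 : ∀ p : ℝ≥0∞, p ≠ ∞ → MemLp (fun ω => γ (fun i => X (ψ i) ω)) p P :=
    fun p hp => hX.memLp_smooth ψ hγ hp
  have m3 : ∀ p : ℝ≥0∞, p ≠ ∞ →
      MemLp (fun ω => fderiv ℝ γ (fun i => X (ψ i) ω) (fun i => ⟪ψ i, h⟫)) p P :=
    fun p hp => hX.memLp_smooth ψ (hγ.fderiv_apply _) hp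
  have m4 : ∀ p : ℝ≥0∞, p ≠ ∞ →
      MemLp (fun ω => fderiv ℝ g (fun i => X (φ i) ω) (fun i => ⟪φ i, h⟫)) p P :=
    fun p hp => hX.memLp_smooth φ (hg.fderiv_apply _) hp
  have i1 := (MemLp.mul_of_forall m1 m3 (p := 1) (by simp)).integrable le_rfl
  have i2 := (MemLp.mul_of_forall m2 m4 (p := 1) (by simp)).integrable le_rfl
  have i3 := (MemLp.mul_of_forall (fun p hp => hX.memLp h hp)
    (fun p hp => MemLp.mul_of_forall m1 m2 hp) (p := 1) (by simp)).integrable le_rfl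
  rw [integral_add i1 i2] at key
  rw [inner_Lp_eq_integral, inner_Lp_eq_integral]
  calc _ = ∫ ω, γ (fun i => X (ψ i) ω) * fderiv ℝ g (fun i => X (φ i) ω) (fun i => ⟪φ i, h⟫) ∂P := by
        refine integral_congr_ae ?_
        filter_upwards [innerLp_coeFn h p.2, hp2, hq1] with ω a1 a2 a3
        rw [a1, a2, a3, fderiv_inner_eq, mul_comm]
    _ = ∫ ω, (X h ω * (g (fun i => X (φ i) ω) * γ (fun i => X (ψ i) ω))
          - g (fun i => X (φ i) ω) * fderiv ℝ γ (fun i => X (ψ i) ω) (fun i => ⟪ψ i, h⟫)) ∂P := by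
        rw [integral_sub i3 i1, key]; ring
    _ = _ := by
        refine integral_congr_ae ?_
        filter_upwards [hp1, mR.coeFn_toLp] with ω a1 a2
        rw [a1, a2]; ring

theorem IsIsonormal.exists_adjoint (hX : IsIsonormal X P) (h : H) {q : Lp ℝ 2 P × Lp H 2 P}
    (hq : q ∈ smoothGraph X P) :
    ∃ R : Lp ℝ 2 P, ∀ p ∈ closure (smoothGraph X P), ⟪innerLp P h p.2, q.1⟫ = ⟪p.1, R⟫ := by
  obtain ⟨R, hR⟩ := hX.exists_adjoint_smooth h hq
  refine ⟨R, fun p hp => ?_⟩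
  have : IsClosed {p : Lp ℝ 2 P × Lp H 2 P | ⟪innerLp P h p.2, q.1⟫ = ⟪p.1, R⟫} :=
    isClosed_eq (((innerLp P h).continuous.comp continuous_snd).inner continuous_const)
      (continuous_fst.inner continuous_const)
  exact closure_minimal hR this hp

/-- A directional derivative of a smooth variable is again smooth. This makes density of the smooth
variables in all of `L²(Ω)` unnecessary for closability: it suffices to test `⟪u - u', h⟫` against
the closed set that contains both `⟪u, h⟫` and `⟪u', h⟫`. -/
theorem IsIsonormal.innerLp_mem_closure (hX : IsIsonormal X P) (h : H)
    {p : Lp ℝ 2 P × Lp H 2 P} (hp : p ∈ closure (smoothGraph X P)) :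
    innerLp P h p.2 ∈ closure (Prod.fst '' smoothGraph X P) := by
  refine map_mem_closure (f := fun p : Lp ℝ 2 P × Lp H 2 P => innerLp P h p.2) (by fun_prop) hp ?_
  rintro p ⟨m, φ, g, hg, hp1, hp2⟩
  refine ⟨_, hX.exists_mem_smoothGraph φ (hg.fderiv_apply (fun i => ⟪φ i, h⟫)), ?_⟩
  refine Lp.ext ?_
  refine (hX.memLp_smooth φ (hg.fderiv_apply _) (by simp)).coeFn_toLp.trans ?_
  filter_upwards [innerLp_coeFn h p.2, hp2] with ω a1 a2
  rw [a1, a2, fderiv_inner_eq]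

/-- By the adjoint identity `⟪u - u', h⟫` is orthogonal to the closure of the smooth variables. Both
terms lie in that closure, so the difference is orthogonal to itself. -/
theorem IsIsonormal.closure_smoothGraph_unique [CompleteSpace H]
    [TopologicalSpace.SeparableSpace H] (hX : IsIsonormal X P) {F : Lp ℝ 2 P} {u u' : Lp H 2 P}
    (hu : (F, u) ∈ closure (smoothGraph X P)) (hu' : (F, u') ∈ closure (smoothGraph X P)) :
    u = u' := by
  have h1 : ∀ h : H, innerLp P h (u - u') = 0 := by
    intro h
    have horth : ∀ G ∈ closure (Prod.fst '' smoothGraph X P), ⟪innerLp P h (u - u'), G⟫ = 0 := by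
      intro G hG
      have hc : IsClosed {G : Lp ℝ 2 P | ⟪innerLp P h (u - u'), G⟫ = 0} :=
        isClosed_eq (continuous_const.inner continuous_id) continuous_const
      refine closure_minimal ?_ hc hG
      rintro _ ⟨q, hq, rfl⟩
      obtain ⟨R, hR⟩ := hX.exists_adjoint h hq
      have e1 := hR _ hu
      have e2 := hR _ hu'
      simp only at e1 e2
      simp only [Set.mem_ofPred_eq]
      rw [map_sub, inner_sub_left, e1, e2, sub_self]
    have e1 := horth _ (hX.innerLp_mem_closure h hu)
    have e2 := horth _ (hX.innerLp_mem_closure h hu')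
    have : ⟪innerLp P h (u - u'), innerLp P h (u - u')⟫ = 0 := by
      nth_rewrite 2 [map_sub]
      rw [inner_sub_right]
      simp only at e1 e2
      rw [e1, e2, sub_zero]
    exact inner_self_eq_zero.1 this
  rw [← sub_eq_zero]
  refine Lp.ext ?_
  refine EventuallyEq.trans ?_ (Lp.coeFn_zero _ _ _).symm
  -- The exceptional null set depends on `h`; separability of `H` reduces to countably many `h`.
  refine ae_eq_zero_of_forall_inner (𝕜 := ℝ) fun h => ?_
  filter_upwards [innerLp_coeFn h (u - u'), (Lp.coeFn_zero ℝ 2 P)] with ω a1 a2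
  rw [h1 h, a2] at a1
  simpa using a1.symm

theorem IsMalliavinDeriv.congr {F F' : Ω → ℝ} {u : Ω → H} (h : IsMalliavinDeriv X P F u)
    (e : F =ᵐ[P] F') : IsMalliavinDeriv X P F' u := by
  obtain ⟨hF, hu, hm⟩ := h
  refine ⟨hF.ae_eq e, hu, ?_⟩
  rwa [(MemLp.toLp_eq_toLp_iff (hF.ae_eq e) hF).2 e.symm]

theorem IsIsonormal.malliavinDeriv_ae_eq [CompleteSpace H]
    [TopologicalSpace.SeparableSpace H] (hX : IsIsonormal X P) {F : Ω → ℝ} {u : Ω → H}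
    (h : IsMalliavinDeriv X P F u) : malliavinDeriv X P F =ᵐ[P] u := by
  have hex : ∃ u : Ω → H, IsMalliavinDeriv X P F u := ⟨u, h⟩
  have hc := hex.choose_spec
  simp only [malliavinDeriv, dif_pos hex]
  obtain ⟨hF, hu, hm⟩ := h
  obtain ⟨hF', hu', hm'⟩ := hc
  exact (MemLp.toLp_eq_toLp_iff hu' hu).1 (hX.closure_smoothGraph_unique hm' hm)

end Closability

/-! ### Moments of the standard normal law. -/

section GaussianMoments

theorem memLp_id_gaussian {p : ℝ≥0∞} (hp : p ≠ ∞) : MemLp (fun x : ℝ => x) p (gaussianReal 0 1) :=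
  memLp_id_gaussianReal' p hp

theorem integrable_pow_gaussian (k : ℕ) : Integrable (fun x : ℝ => x ^ k) (gaussianReal 0 1) := by
  refine (memLp_of_norm_le_pow (Φ := fun x : ℝ => x) (fun p hp => memLp_id_gaussian hp)
    (g := fun x : ℝ => x ^ k) (by fun_prop) (C := 1) (k := k) (fun x => ?_)
    (p := 1) (by simp)).integrable le_rfl
  rw [norm_pow, one_mul]
  gcongr
  simp

theorem integral_pow_gaussian (k : ℕ) :
    ∫ x : ℝ, x ^ (k + 2) ∂(gaussianReal 0 1) = (k + 1) * ∫ x : ℝ, x ^ k ∂(gaussianReal 0 1) := by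
  have := integral_id_mul_gaussianReal (v := 1) one_ne_zero (f := fun x => x ^ (k + 1))
    (f' := fun x => (k + 1) * x ^ k) (fun x => by simpa using hasDerivAt_pow (k + 1) x)
    (integrable_pow_gaussian _) (by simpa [pow_succ'] using integrable_pow_gaussian (k + 2))
    ((integrable_pow_gaussian k).const_mul _)
  rw [integral_const_mul] at this
  simp only [NNReal.coe_one, one_mul] at this
  rw [← this]
  congr 1; ext x; ring

end GaussianMoments

/-! ### Orthogonality of Hermite polynomials to degree two. -/

section Hermite

variable {H Ω : Type*} [NormedAddCommGroup H] [InnerProductSpace ℝ H] [MeasurableSpace Ω]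
  {P : Measure Ω} [IsProbabilityMeasure P] {X : H → Ω → ℝ}

theorem hasTemperateGrowth_eval {ι : Type*} [Fintype ι] (p : Polynomial ℝ) (i : ι) :
    (fun x : ι → ℝ => p.eval (x i)).HasTemperateGrowth := by
  simp only [Polynomial.eval_eq_sum_range]
  refine Function.HasTemperateGrowth.sum fun k _ => ?_
  have h1 : (fun x : ι → ℝ => x i).HasTemperateGrowth :=
    (ContinuousLinearMap.proj (R := ℝ) (φ := fun _ : ι => ℝ) i).hasTemperateGrowth
  exact (Function.HasTemperateGrowth.const (p.coeff k)).mul (h1.pow k)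

theorem IsIsonormal.memLp_eval (hX : IsIsonormal X P) (h : H) (p : Polynomial ℝ) {q : ℝ≥0∞}
    (hq : q ≠ ∞) : MemLp (fun ω => p.eval (X h ω)) q P :=
  hX.memLp_smooth (fun _ : Unit => h) (hasTemperateGrowth_eval p ()) hq

/-- The Hermite polynomial with real coefficients. -/
noncomputable def hermiteReal (n : ℕ) : Polynomial ℝ :=
  (Polynomial.hermite n).map (algebraMap ℤ ℝ)

theorem hermiteReal_succ (n : ℕ) : hermiteReal (n + 1)
    = Polynomial.X * hermiteReal n - Polynomial.derivative (hermiteReal n) := by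
  simp [hermiteReal, Polynomial.hermite_succ, Polynomial.derivative_map]

theorem hermiteReal_zero : hermiteReal 0 = 1 := by simp [hermiteReal]

theorem hermiteReal_one : hermiteReal 1 = Polynomial.X := by
  rw [hermiteReal_succ, hermiteReal_zero]; simp

theorem hermiteReal_two : hermiteReal 2 = Polynomial.X ^ 2 - 1 := by
  rw [hermiteReal_succ, hermiteReal_one]; simp [sq]

theorem aeval_hermite (n : ℕ) (x : ℝ) :
    Polynomial.aeval x (Polynomial.hermite n) = (hermiteReal n).eval x := by
  rw [hermiteReal, Polynomial.aeval_def, Polynomial.eval₂_eq_eval_map]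

/-- Since `H_{n+1} = x H_n - H_n'`, integration by parts in `X h` cancels the `H_n'` term and leaves
the derivative on `r`. -/
theorem IsIsonormal.integral_hermite_succ_mul (hX : IsIsonormal X P) {g h : H} (hh : ‖h‖ = 1)
    (n : ℕ) (r : Polynomial ℝ) :
    ∫ ω, (hermiteReal (n + 1)).eval (X h ω) * r.eval (X g ω) ∂P
      = ⟪g, h⟫ * ∫ ω, (hermiteReal n).eval (X h ω) * (Polynomial.derivative r).eval (X g ω) ∂P := by
  set p := hermiteReal n with hp
  have key := hX.integral_mul_comp h ![h, g]
    ((hasTemperateGrowth_eval p (0 : Fin 2)).mul (hasTemperateGrowth_eval r (1 : Fin 2)))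
  have hfd : ∀ x a : Fin 2 → ℝ, fderiv ℝ ((fun x : Fin 2 → ℝ => p.eval (x 0)) *
      fun x : Fin 2 → ℝ => r.eval (x 1)) x a
      = p.eval (x 0) * ((Polynomial.derivative r).eval (x 1) * a 1)
        + r.eval (x 1) * ((Polynomial.derivative p).eval (x 0) * a 0) := by
    intro x a
    have e : ∀ (q : Polynomial ℝ) (i : Fin 2), HasFDerivAt (fun x : Fin 2 → ℝ => q.eval (x i))
        ((Polynomial.derivative q).eval (x i) •
          ContinuousLinearMap.proj (R := ℝ) (φ := fun _ : Fin 2 => ℝ) i) x := fun q i =>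
      HasDerivAt.comp_hasFDerivAt (h₂ := fun y => q.eval y) x (q.hasDerivAt (x i))
        (ContinuousLinearMap.proj (R := ℝ) (φ := fun _ : Fin 2 => ℝ) i).hasFDerivAt
    rw [((e p 0).mul (e r 1)).fderiv]
    simp
  simp only [hfd, Pi.mul_apply] at key
  simp only [Matrix.cons_val_zero, Matrix.cons_val_one, real_inner_self_eq_norm_sq, hh, one_pow,
    mul_one] at key
  have I : ∀ a b : Polynomial ℝ, Integrable (fun ω => a.eval (X h ω) * b.eval (X g ω)) P :=
    fun a b => (hX.memLp_eval h a (q := 2) (by simp)).integrable_mul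
      (hX.memLp_eval g b (q := 2) (by simp))
  have I2 : Integrable (fun ω => X h ω * (p.eval (X h ω) * r.eval (X g ω))) P := by
    refine (I (Polynomial.X * p) r).congr (ae_of_all _ fun ω => ?_)
    simp; ring
  calc _ = ∫ ω, (X h ω * (p.eval (X h ω) * r.eval (X g ω))
        - (Polynomial.derivative p).eval (X h ω) * r.eval (X g ω)) ∂P := by
        refine integral_congr_ae (ae_of_all _ fun ω => ?_)
        simp [hermiteReal_succ, ← hp]; ring
    _ = _ := by
        rw [integral_sub I2 (I _ _), key, ← integral_sub, ← integral_const_mul]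
        · refine integral_congr_ae (ae_of_all _ fun ω => ?_)
          simp; ring
        · refine Integrable.add ?_ ?_
          · refine ((I p (Polynomial.derivative r)).mul_const ⟪g, h⟫).congr (ae_of_all _ fun ω => ?_)
            simp; ring
          · refine (I (Polynomial.derivative p) r).congr (ae_of_all _ fun ω => ?_)
            simp; ring
        · exact I _ _

/-- Hermite polynomials of degree `q ≠ 0, 2` are orthogonal to those of degree two. -/
theorem IsIsonormal.integral_hermite_mul_sq_sub_one (hX : IsIsonormal X P) {g h : H}
    (hh : ‖h‖ = 1) {q : ℕ} (hq0 : q ≠ 0) (hq : q ≠ 2) :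
    ∫ ω, (hermiteReal q).eval (X h ω) * ((X g ω) ^ 2 - 1) ∂P = 0 := by
  have e : ∀ ω, (X g ω) ^ 2 - 1 = (Polynomial.X ^ 2 - 1 : Polynomial ℝ).eval (X g ω) := by simp
  simp only [e]
  obtain ⟨n, rfl⟩ := Nat.exists_eq_succ_of_ne_zero hq0
  rw [hX.integral_hermite_succ_mul hh]
  rcases n with _ | _ | n
  · simp [hermiteReal_zero, integral_const_mul, hX.centered]
  · exact absurd rfl hq
  -- For `q ≥ 3` three derivatives land on a quadratic polynomial.
  · rw [hX.integral_hermite_succ_mul hh, hX.integral_hermite_succ_mul hh]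
    simp

end Hermite

/-! ### Orthogonal series in a Hilbert space. -/

section Orthogonal

/-- Passing to spans instead of normalised vectors allows some `f i` to be zero. -/
theorem orthogonalFamily_span {E : Type*} [NormedAddCommGroup E] [InnerProductSpace ℝ E]
    {f : ℕ → E} (hf : Pairwise fun i j => ⟪f i, f j⟫ = 0) :
    OrthogonalFamily ℝ (fun i => (ℝ ∙ f i)) (fun i => (ℝ ∙ f i).subtypeₗᵢ) := by
  intro i j hij x y
  obtain ⟨a, ha⟩ := Submodule.mem_span_singleton.1 x.2
  obtain ⟨b, hb⟩ := Submodule.mem_span_singleton.1 y.2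
  change ⟪(x : E), (y : E)⟫ = 0
  rw [← ha, ← hb, inner_smul_left, inner_smul_right, hf hij, mul_zero, mul_zero]

theorem summable_of_pairwise_orthogonal {E : Type*} [NormedAddCommGroup E] [InnerProductSpace ℝ E]
    [CompleteSpace E] {f : ℕ → E} (hf : Pairwise fun i j => ⟪f i, f j⟫ = 0)
    (hs : Summable fun i => ‖f i‖ ^ 2) : Summable f :=
  ((orthogonalFamily_span hf).summable_iff_norm_sq_summable
    (fun i => ⟨f i, Submodule.mem_span_singleton_self _⟩)).2 hs

theorem norm_sum_sq_of_pairwise_orthogonal {E : Type*} [NormedAddCommGroup E]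
    [InnerProductSpace ℝ E] {f : ℕ → E} (hf : Pairwise fun i j => ⟪f i, f j⟫ = 0)
    (s : Finset ℕ) : ‖∑ i ∈ s, f i‖ ^ 2 = ∑ i ∈ s, ‖f i‖ ^ 2 :=
  (orthogonalFamily_span hf).norm_sum
    (fun i => ⟨f i, Submodule.mem_span_singleton_self _⟩) s

theorem norm_tsum_sq_of_pairwise_orthogonal {E : Type*} [NormedAddCommGroup E]
    [InnerProductSpace ℝ E] [CompleteSpace E] {f : ℕ → E} (hf : Pairwise fun i j => ⟪f i, f j⟫ = 0)
    (hs : Summable fun i => ‖f i‖ ^ 2) : ‖∑' i, f i‖ ^ 2 = ∑' i, ‖f i‖ ^ 2 := by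
  have h1 := (summable_of_pairwise_orthogonal hf hs).hasSum.tendsto_sum_nat.norm.pow 2
  simp only [norm_sum_sq_of_pairwise_orthogonal hf] at h1
  exact tendsto_nhds_unique h1 hs.hasSum.tendsto_sum_nat

end Orthogonal

/-! ### Diagonal series in the second chaos, their derivatives and carré du champ. -/

section SecondChaos

variable {H Ω : Type*} [NormedAddCommGroup H] [InnerProductSpace ℝ H] [CompleteSpace H]
  [MeasurableSpace Ω]
  {P : Measure Ω} [IsProbabilityMeasure P] {X : H → Ω → ℝ}

theorem IsIsonormal.memLp_sq_sub_one (hX : IsIsonormal X P) (h : H) {p : ℝ≥0∞} (hp : p ≠ ∞) :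
    MemLp (fun ω => (X h ω) ^ 2 - 1) p P := by
  have := hX.memLp_eval h (Polynomial.X ^ 2 - 1) hp
  simp only [Polynomial.eval_sub, Polynomial.eval_pow, Polynomial.eval_X, Polynomial.eval_one] at this
  exact this

/-- The element `X(h)² - 1` of `L²(Ω)`. -/
noncomputable def sqLp (hX : IsIsonormal X P) (h : H) : Lp ℝ 2 P :=
  (hX.memLp_sq_sub_one h (p := 2) (by simp)).toLp (fun ω => (X h ω) ^ 2 - 1)

theorem sqLp_coeFn (hX : IsIsonormal X P) (h : H) : sqLp hX h =ᵐ[P] fun ω => (X h ω) ^ 2 - 1 :=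
  MemLp.coeFn_toLp _

theorem IsIsonormal.memLp_smul (hX : IsIsonormal X P) (h : H) {p : ℝ≥0∞} (hp : p ≠ ∞) :
    MemLp (fun ω => X h ω • h) p P := by
  refine ((hX.memLp h hp).norm.mul_const ‖h‖).of_le
    ((hX.memLp h hp).1.smul_const _) (ae_of_all _ fun ω => ?_)
  rw [norm_smul]
  exact le_abs_self _

/-- The element `X(h) h` of `L²(Ω; H)`. -/
noncomputable def derivLp (hX : IsIsonormal X P) (h : H) : Lp H 2 P :=
  (hX.memLp_smul h (p := 2) (by simp)).toLp (fun ω => X h ω • h)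

theorem derivLp_coeFn (hX : IsIsonormal X P) (h : H) : derivLp hX h =ᵐ[P] fun ω => X h ω • h :=
  MemLp.coeFn_toLp _

theorem IsIsonormal.integral_comp_of_norm_eq_one (hX : IsIsonormal X P) {h : H} (hh : ‖h‖ = 1)
    {f : ℝ → ℝ} (hf : Continuous f) :
    ∫ ω, f (X h ω) ∂P = ∫ x, f x ∂(gaussianReal 0 1) := by
  have hn : ‖h‖₊ = 1 := by ext; simpa using hh
  rw [← integral_map (hX.aemeasurable h) hf.aestronglyMeasurable, hX.map_eq h, hn, one_pow]

/-- The fifth power is not needed: in the expansion of `(S + Y) ^ 6` it is multiplied by the mean of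
`S`, which is zero. -/
theorem integral_sq_sub_one_pow_gaussian :
    ∫ x : ℝ, (x ^ 2 - 1) ∂(gaussianReal 0 1) = 0 ∧
    ∫ x : ℝ, (x ^ 2 - 1) ^ 2 ∂(gaussianReal 0 1) = 2 ∧
    ∫ x : ℝ, (x ^ 2 - 1) ^ 3 ∂(gaussianReal 0 1) = 8 ∧
    ∫ x : ℝ, (x ^ 2 - 1) ^ 4 ∂(gaussianReal 0 1) = 60 ∧
    ∫ x : ℝ, (x ^ 2 - 1) ^ 6 ∂(gaussianReal 0 1) = 6040 := by
  have I := integrable_pow_gaussian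
  have h0 : ∫ x : ℝ, x ^ 0 ∂(gaussianReal 0 1) = 1 := by simp
  have h2 := integral_pow_gaussian 0
  have h4 := integral_pow_gaussian 2
  have h6 := integral_pow_gaussian 4
  have h8 := integral_pow_gaussian 6
  have h10 := integral_pow_gaussian 8
  have h12 := integral_pow_gaussian 10
  norm_num at h2 h4 h6 h8 h10 h12
  have I1 : Integrable (fun _ : ℝ => (1 : ℝ)) (gaussianReal 0 1) := integrable_const 1
  have c1 : ∫ _ : ℝ, (1 : ℝ) ∂(gaussianReal 0 1) = 1 := by simp
  refine ⟨?_, ?_, ?_, ?_, ?_⟩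
  · rw [integral_sub (by fun_prop) (by fun_prop), h2, c1]; norm_num
  · have e : ∀ x : ℝ, (x ^ 2 - 1) ^ 2 = x ^ 4 + (-2) * x ^ 2 + 1 := fun x => by ring
    simp only [e]
    rw [integral_add (by fun_prop) (by fun_prop), integral_add (by fun_prop) (by fun_prop),
      integral_const_mul, h4, h2, c1]
    norm_num
  · have e : ∀ x : ℝ, (x ^ 2 - 1) ^ 3 = x ^ 6 + (-3) * x ^ 4 + 3 * x ^ 2 - 1 := fun x => by ring
    simp only [e]
    rw [integral_sub (by fun_prop) (by fun_prop), integral_add (by fun_prop) (by fun_prop),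
      integral_add (by fun_prop) (by fun_prop),
      integral_const_mul, integral_const_mul, h6, h4, h2, c1]
    norm_num
  · have e : ∀ x : ℝ, (x ^ 2 - 1) ^ 4 = x ^ 8 + (-4) * x ^ 6 + 6 * x ^ 4 + (-4) * x ^ 2 + 1 :=
      fun x => by ring
    simp only [e]
    rw [integral_add (by fun_prop) (by fun_prop), integral_add (by fun_prop) (by fun_prop),
      integral_add (by fun_prop) (by fun_prop), integral_add (by fun_prop) (by fun_prop),
      integral_const_mul, integral_const_mul, integral_const_mul, h8, h6, h4, h2, c1]
    norm_num
  · have e : ∀ x : ℝ, (x ^ 2 - 1) ^ 6 = x ^ 12 + (-6) * x ^ 10 + 15 * x ^ 8 + (-20) * x ^ 6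
      + 15 * x ^ 4 + (-6) * x ^ 2 + 1 := fun x => by ring
    simp only [e]
    rw [integral_add (by fun_prop) (by fun_prop), integral_add (by fun_prop) (by fun_prop),
      integral_add (by fun_prop) (by fun_prop), integral_add (by fun_prop) (by fun_prop),
      integral_add (by fun_prop) (by fun_prop), integral_add (by fun_prop) (by fun_prop),
      integral_const_mul, integral_const_mul, integral_const_mul, integral_const_mul,
      integral_const_mul, h12, h10, h8, h6, h4, h2, c1]
    norm_num

theorem IsIsonormal.integral_sq_sub_one (hX : IsIsonormal X P) {h : H} (hh : ‖h‖ = 1) :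
    ∫ ω, ((X h ω) ^ 2 - 1) ∂P = 0 := by
  rw [hX.integral_comp_of_norm_eq_one hh (f := fun x => x ^ 2 - 1) (by fun_prop)]
  exact integral_sq_sub_one_pow_gaussian.1

theorem norm_sqLp (hX : IsIsonormal X P) {h : H} (hh : ‖h‖ = 1) : ‖sqLp hX h‖ ^ 2 = 2 := by
  rw [← real_inner_self_eq_norm_sq, inner_Lp_eq_integral,
    ← integral_sq_sub_one_pow_gaussian.2.1,
    ← hX.integral_comp_of_norm_eq_one hh (f := fun x => (x ^ 2 - 1) ^ 2) (by fun_prop)]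
  refine integral_congr_ae ?_
  filter_upwards [sqLp_coeFn hX h] with ω hω
  rw [hω, sq ((X h ω) ^ 2 - 1)]

theorem inner_sqLp (hX : IsIsonormal X P) {g h : H} (hg : ‖g‖ = 1) (hgh : ⟪g, h⟫ = 0) :
    ⟪sqLp hX g, sqLp hX h⟫ = 0 := by
  have hind : IndepFun (X g) (X h) P :=
    (hX.isGaussianProcess.hasGaussianLaw_prodMk (s := g) (t := h)).indepFun_of_covariance_eq_zero
      (by rw [hX.cov, hgh])
  rw [inner_Lp_eq_integral]
  have h1 := hind.integral_fun_comp_mul_comp (hX.aemeasurable g) (hX.aemeasurable h)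
    (f := fun x => x ^ 2 - 1) (g := fun x => x ^ 2 - 1)
    (by fun_prop) (by fun_prop)
  rw [hX.integral_sq_sub_one hg, zero_mul] at h1
  rw [← h1]
  refine integral_congr_ae ?_
  filter_upwards [sqLp_coeFn hX h, sqLp_coeFn hX g] with ω h1 h2
  rw [h1, h2]

theorem integral_sqLp (hX : IsIsonormal X P) {h : H} (hh : ‖h‖ = 1) :
    ∫ ω, sqLp hX h ω ∂P = 0 := by
  rw [integral_congr_ae (sqLp_coeFn hX h), hX.integral_sq_sub_one hh]

theorem inner_derivLp (hX : IsIsonormal X P) (g h : H) :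
    ⟪derivLp hX g, derivLp hX h⟫ = ⟪g, h⟫ ^ 2 := by
  rw [L2.inner_def, sq]
  nth_rewrite 2 [← hX.covariance g h]
  rw [← integral_const_mul]
  refine integral_congr_ae ?_
  filter_upwards [derivLp_coeFn hX h, derivLp_coeFn hX g] with ω h1 h2
  rw [h1, h2, real_inner_smul_left, real_inner_smul_right]
  ring

/-- Square summable coefficients `a` over an orthogonal system `e` which is normalized wherever
`a` does not vanish. -/
structure IsChaosCoeff (e : ℕ → H) (a : ℕ → ℝ) : Prop where
  orth : Pairwise fun i j => ⟪e i, e j⟫ = 0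
  unit : ∀ i, a i ≠ 0 → ‖e i‖ = 1
  summable : Summable fun i => a i ^ 2

variable {e : ℕ → H} {a b : ℕ → ℝ}

theorem IsChaosCoeff.pairwise_sqLp (hX : IsIsonormal X P) (ha : IsChaosCoeff e a) :
    Pairwise fun i j => ⟪a i • sqLp hX (e i), a j • sqLp hX (e j)⟫ = 0 := by
  intro i j hij
  simp only [real_inner_smul_left, real_inner_smul_right]
  by_cases hi : a i = 0
  · simp [hi]
  · rw [inner_sqLp hX (ha.unit i hi) (ha.orth hij)]; simp

theorem IsChaosCoeff.norm_sq_smul_sqLp (hX : IsIsonormal X P) (ha : IsChaosCoeff e a) (i : ℕ) :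
    ‖a i • sqLp hX (e i)‖ ^ 2 = 2 * a i ^ 2 := by
  rw [norm_smul, mul_pow, Real.norm_eq_abs, sq_abs]
  by_cases hi : a i = 0
  · simp [hi]
  · rw [norm_sqLp hX (ha.unit i hi), mul_comm]

theorem IsChaosCoeff.summable_sqLp (hX : IsIsonormal X P) (ha : IsChaosCoeff e a) :
    Summable fun i => a i • sqLp hX (e i) := by
  refine summable_of_pairwise_orthogonal (ha.pairwise_sqLp hX) ?_
  simp only [ha.norm_sq_smul_sqLp hX]
  exact ha.summable.mul_left 2

theorem IsChaosCoeff.summable_derivLp (hX : IsIsonormal X P) (ha : IsChaosCoeff e a) :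
    Summable fun i => (2 * a i) • derivLp hX (e i) := by
  refine summable_of_pairwise_orthogonal ?_ ?_
  · intro i j hij
    simp [real_inner_smul_left, real_inner_smul_right, inner_derivLp, ha.orth hij]
  · refine (ha.summable.mul_left 4).congr fun i => ?_
    rw [norm_smul, mul_pow, ← real_inner_self_eq_norm_sq (derivLp hX (e i)), inner_derivLp,
      real_inner_self_eq_norm_sq, Real.norm_eq_abs, sq_abs]
    by_cases hi : a i = 0
    · simp [hi]
    · rw [ha.unit i hi]; ring

/-- The random variable `k + ∑ i, a i (X(e i)² - 1)`. -/
noncomputable def chaosSum (hX : IsIsonormal X P) (e : ℕ → H) (a : ℕ → ℝ) (k : ℝ) : Lp ℝ 2 P :=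
  Lp.const 2 P k + ∑' i, a i • sqLp hX (e i)

/-- The random vector `∑ i, 2 a i X(e i) e i`. -/
noncomputable def derivSum (hX : IsIsonormal X P) (e : ℕ → H) (a : ℕ → ℝ) : Lp H 2 P :=
  ∑' i, (2 * a i) • derivLp hX (e i)

/-- The constant may vary with `m` because the carré du champ of partial sums produces a partial sum
of constants. -/
theorem IsChaosCoeff.tendsto_chaosSum (hX : IsIsonormal X P) (ha : IsChaosCoeff e a) {k : ℝ}
    {κ : ℕ → ℝ} (hk : Tendsto κ atTop (𝓝 k)) :
    Tendsto (fun m => Lp.const 2 P (κ m) + ∑ i ∈ Finset.range m, a i • sqLp hX (e i)) atTop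
      (𝓝 (chaosSum hX e a k)) :=
  (((Lp.constL 2 P ℝ (E := ℝ)).continuous.tendsto k).comp hk).add
    (ha.summable_sqLp hX).hasSum.tendsto_sum_nat

theorem IsChaosCoeff.tendsto_derivSum (hX : IsIsonormal X P) (ha : IsChaosCoeff e a) :
    Tendsto (fun m => ∑ i ∈ Finset.range m, (2 * a i) • derivLp hX (e i)) atTop
      (𝓝 (derivSum hX e a)) :=
  (ha.summable_derivLp hX).hasSum.tendsto_sum_nat

theorem chaosPartial_coeFn (hX : IsIsonormal X P) (e : ℕ → H) (a : ℕ → ℝ) (k : ℝ) (m : ℕ) :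
    (Lp.const 2 P k + ∑ i ∈ Finset.range m, a i • sqLp hX (e i) : Lp ℝ 2 P)
      =ᵐ[P] fun ω => k + ∑ i ∈ Finset.range m, a i * ((X (e i) ω) ^ 2 - 1) := by
  have h1 : ∀ᵐ ω ∂P, ∀ i, (a i • sqLp hX (e i) : Lp ℝ 2 P) ω = a i * ((X (e i) ω) ^ 2 - 1) := by
    refine ae_all_iff.2 fun i => ?_
    filter_upwards [Lp.coeFn_smul (a i) (sqLp hX (e i)), sqLp_coeFn hX (e i)] with ω h1 h2
    rw [h1, Pi.smul_apply, h2, smul_eq_mul]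
  filter_upwards [Lp.coeFn_add (Lp.const 2 P k) (∑ i ∈ Finset.range m, a i • sqLp hX (e i)),
    Lp.coeFn_const 2 P k, Lp.coeFn_finsetSum (Finset.range m) (fun i => a i • sqLp hX (e i)), h1]
    with ω h2 h3 h4 h5
  rw [h2, Pi.add_apply, h3, h4]
  simp [h5]

theorem derivPartial_coeFn (hX : IsIsonormal X P) (e : ℕ → H) (a : ℕ → ℝ) (m : ℕ) :
    (∑ i ∈ Finset.range m, (2 * a i) • derivLp hX (e i) : Lp H 2 P)
      =ᵐ[P] fun ω => ∑ i ∈ Finset.range m, (2 * a i * X (e i) ω) • e i := by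
  have h1 : ∀ᵐ ω ∂P, ∀ i, ((2 * a i) • derivLp hX (e i) : Lp H 2 P) ω
      = (2 * a i * X (e i) ω) • e i := by
    refine ae_all_iff.2 fun i => ?_
    filter_upwards [Lp.coeFn_smul (2 * a i) (derivLp hX (e i)), derivLp_coeFn hX (e i)] with ω h1 h2
    rw [h1, Pi.smul_apply, h2, smul_smul]
  filter_upwards [Lp.coeFn_finsetSum (Finset.range m) (fun i => (2 * a i) • derivLp hX (e i)), h1]
    with ω h4 h5
  rw [h4]
  simp [h5]

theorem partial_mem_smoothGraph (hX : IsIsonormal X P) (e : ℕ → H) (a : ℕ → ℝ) (k : ℝ) (m : ℕ) :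
    (Lp.const 2 P k + ∑ i ∈ Finset.range m, a i • sqLp hX (e i),
      ∑ i ∈ Finset.range m, (2 * a i) • derivLp hX (e i)) ∈ smoothGraph X P := by
  have hp : ∀ i : Fin m, (fun x : Fin m → ℝ => x i).HasTemperateGrowth := fun i =>
    (ContinuousLinearMap.proj (R := ℝ) (φ := fun _ : Fin m => ℝ) i).hasTemperateGrowth
  refine ⟨m, fun i => e i, fun x => k + ∑ i : Fin m, a i * (x i ^ 2 - 1), ?_, ?_, ?_⟩
  · refine (Function.HasTemperateGrowth.const k).add
      (Function.HasTemperateGrowth.sum fun i _ => ?_)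
    exact (Function.HasTemperateGrowth.const (a i)).mul
      (((hp i).pow 2).sub (Function.HasTemperateGrowth.const 1))
  · filter_upwards [chaosPartial_coeFn hX e a k m] with ω h
    rw [h, Finset.sum_range]
  · have hfd : ∀ x : Fin m → ℝ, ∀ j, fderiv ℝ (fun x : Fin m → ℝ =>
        k + ∑ i : Fin m, a i * (x i ^ 2 - 1)) x (Pi.single j 1) = 2 * a j * x j := by
      intro x j
      have e1 : ∀ i : Fin m, HasFDerivAt (fun x : Fin m → ℝ => a i * (x i ^ 2 - 1))
          ((2 * a i * x i) • ContinuousLinearMap.proj (R := ℝ) (φ := fun _ : Fin m => ℝ) i) x := by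
        intro i
        have h1 : HasDerivAt (fun y : ℝ => a i * (y ^ 2 - 1)) (2 * a i * x i) (x i) := by
          have := (((hasDerivAt_id (x i)).pow 2).sub_const 1).const_mul (a i)
          convert! this using 1
          simp; ring
        exact HasDerivAt.comp_hasFDerivAt (h₂ := fun y : ℝ => a i * (y ^ 2 - 1)) x h1
          (ContinuousLinearMap.proj (R := ℝ) (φ := fun _ : Fin m => ℝ) i).hasFDerivAt
      have e2 := (HasFDerivAt.fun_sum (u := Finset.univ) fun i _ => e1 i).const_add k
      rw [e2.fderiv]
      simp [Pi.single_apply]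
    filter_upwards [derivPartial_coeFn hX e a m] with ω h
    rw [h, Finset.sum_range]
    simp only [hfd]

theorem IsChaosCoeff.isMalliavinDeriv (hX : IsIsonormal X P) (ha : IsChaosCoeff e a) (k : ℝ) :
    IsMalliavinDeriv X P (chaosSum hX e a k) (derivSum hX e a) := by
  refine ⟨Lp.memLp _, Lp.memLp _, ?_⟩
  rw [Lp.toLp_coeFn, Lp.toLp_coeFn]
  exact mem_closure_of_tendsto
    ((ha.tendsto_chaosSum hX tendsto_const_nhds).prodMk_nhds (ha.tendsto_derivSum hX))
    (Eventually.of_forall fun m => partial_mem_smoothGraph hX e a k m)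

theorem tendstoInMeasure_Lp {E : Type*} [NormedAddCommGroup E] {f : ℕ → Lp E 2 P} {g : Lp E 2 P}
    (h : Tendsto f atTop (𝓝 g)) : TendstoInMeasure P (fun n => (f n : Ω → E)) atTop g :=
  tendstoInMeasure_of_tendsto_Lp h

/-- The carré du champ of two elements of the second chaos. -/
theorem IsChaosCoeff.inner_derivSum (hX : IsIsonormal X P) (ha : IsChaosCoeff e a)
    (hb : IsChaosCoeff e b) (hab : IsChaosCoeff e fun i => 4 * a i * b i) :
    (fun ω => ⟪derivSum hX e a ω, derivSum hX e b ω⟫)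
      =ᵐ[P] chaosSum hX e (fun i => 4 * a i * b i) (∑' i, 4 * a i * b i) := by
  have hsum : Summable fun i => 4 * a i * b i := by
    refine Summable.of_norm_bounded (((ha.summable.add hb.summable).mul_left 2)) fun i => ?_
    rw [Real.norm_eq_abs, abs_le]
    constructor <;> nlinarith [sq_nonneg (a i - b i), sq_nonneg (a i + b i)]
  -- Successive subsequences make all three series converge almost surely along `n1 ∘ n2 ∘ n3`, so
  -- the identity can be passed to the limit pointwise.
  obtain ⟨n1, hn1, h1⟩ := (tendstoInMeasure_Lp (ha.tendsto_derivSum hX)).exists_seq_tendsto_ae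
  obtain ⟨n2, hn2, h2⟩ := (tendstoInMeasure_Lp
    ((hb.tendsto_derivSum hX).comp hn1.tendsto_atTop)).exists_seq_tendsto_ae
  obtain ⟨n3, hn3, h3⟩ := (tendstoInMeasure_Lp
    ((hab.tendsto_chaosSum hX hsum.hasSum.tendsto_sum_nat).comp
      (hn1.comp hn2).tendsto_atTop)).exists_seq_tendsto_ae
  have c1 := ae_all_iff.2 fun m => derivPartial_coeFn hX e a m
  have c2 := ae_all_iff.2 fun m => derivPartial_coeFn hX e b m
  have c3 := ae_all_iff.2 fun m => chaosPartial_coeFn hX e (fun i => 4 * a i * b i)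
    (∑ i ∈ Finset.range m, 4 * a i * b i) m
  filter_upwards [h1, h2, h3, c1, c2, c3] with ω h1 h2 h3 c1 c2 c3
  simp only [Function.comp_apply] at h2 h3
  have t1 := (h1.comp (hn2.comp hn3).tendsto_atTop).inner (h2.comp hn3.tendsto_atTop) (𝕜 := ℝ)
  refine tendsto_nhds_unique t1 (h3.congr fun j => ?_)
  simp only [Function.comp_apply]
  -- Only diagonal terms survive, and `X² = (X² - 1) + 1` splits each into a chaos term and a
  -- contribution to the constant.
  rw [c1, c2, c3, inner_sum, ← Finset.sum_add_distrib]
  refine Finset.sum_congr rfl fun i hi => ?_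
  rw [sum_inner, Finset.sum_eq_single i]
  · rw [real_inner_smul_left, real_inner_smul_right, real_inner_self_eq_norm_sq]
    by_cases h0 : a i = 0
    · simp [h0]
    · rw [ha.unit i h0]; ring
  · intro j _ hj
    rw [real_inner_smul_left, real_inner_smul_right, ha.orth hj]; simp
  · exact fun h => absurd hi h

end SecondChaos

/-! ### The operators `L⁻¹` and `Γ_r` on the second chaos, and the resulting variances. -/

section GammaOperators

variable {H Ω : Type*} [NormedAddCommGroup H] [InnerProductSpace ℝ H] [CompleteSpace H]
  [MeasurableSpace Ω] {P : Measure Ω} [IsProbabilityMeasure P] {X : H → Ω → ℝ}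
  {e : ℕ → H} {a b : ℕ → ℝ}

theorem chaosSum_smul (hX : IsIsonormal X P) (r k : ℝ) :
    r • chaosSum hX e a k = chaosSum hX e (fun i => r * a i) (r * k) := by
  rw [chaosSum, chaosSum, smul_add, ← tsum_const_smul'']
  simp only [smul_smul]
  congr 1

theorem IsChaosCoeff.chaosSum_sub (hX : IsIsonormal X P) (ha : IsChaosCoeff e a)
    (hb : IsChaosCoeff e b) (k l : ℝ) :
    chaosSum hX e a k - chaosSum hX e b l = chaosSum hX e (fun i => a i - b i) (k - l) := by
  simp only [chaosSum, sub_smul]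
  rw [(ha.summable_sqLp hX).tsum_sub (hb.summable_sqLp hX), map_sub]
  abel

theorem IsChaosCoeff.mono (ha : IsChaosCoeff e a) {C : ℝ} (h : ∀ i, |b i| ≤ C * |a i|) :
    IsChaosCoeff e b where
  orth := ha.orth
  unit i hi := ha.unit i fun h0 => hi <| by
    have := h i
    rw [h0, abs_zero, mul_zero] at this
    exact abs_nonpos_iff.1 this
  summable := by
    refine Summable.of_nonneg_of_le (fun i => by positivity) (fun i => ?_)
      (ha.summable.mul_left (C ^ 2))
    rw [← sq_abs (b i), ← sq_abs (a i), ← mul_pow]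
    exact pow_le_pow_left₀ (abs_nonneg _) (h i) 2

theorem sqLp_mem_wienerChaos (hX : IsIsonormal X P) {h : H} (hh : ‖h‖ = 1) :
    sqLp hX h ∈ wienerChaos X P 2 := by
  refine Submodule.le_topologicalClosure _ (Submodule.subset_span ⟨h, fun _ => hh, ?_⟩)
  filter_upwards [sqLp_coeFn hX h] with ω hω
  rw [hω, aeval_hermite, hermiteReal_two]
  simp

theorem IsChaosCoeff.chaosSum_mem_wienerChaos (hX : IsIsonormal X P) (ha : IsChaosCoeff e a) :
    chaosSum hX e a 0 ∈ wienerChaos X P 2 := by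
  have hc : IsClosed (wienerChaos X P 2 : Set (Lp ℝ 2 P)) :=
    Submodule.isClosed_topologicalClosure _
  refine hc.mem_of_tendsto (ha.tendsto_chaosSum hX (k := 0) (κ := fun _ => 0) tendsto_const_nhds)
    (Eventually.of_forall fun m => ?_)
  rw [map_zero, zero_add]
  refine Submodule.sum_mem _ fun i _ => ?_
  by_cases hi : a i = 0
  · rw [hi, zero_smul]; exact Submodule.zero_mem _
  · exact Submodule.smul_mem _ _ (sqLp_mem_wienerChaos hX (ha.unit i hi))

theorem IsChaosCoeff.chaosSum_mem_orthogonal (hX : IsIsonormal X P) (ha : IsChaosCoeff e a) {q : ℕ}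
    (hq0 : q ≠ 0) (hq : q ≠ 2) : chaosSum hX e a 0 ∈ (wienerChaos X P q)ᗮ := by
  have hc : IsClosed ((wienerChaos X P q)ᗮ : Set (Lp ℝ 2 P)) :=
    Submodule.isClosed_orthogonal _
  refine hc.mem_of_tendsto (ha.tendsto_chaosSum hX (k := 0) (κ := fun _ => 0) tendsto_const_nhds)
    (Eventually.of_forall fun m => ?_)
  rw [map_zero, zero_add]
  refine Submodule.sum_mem _ fun i _ => ?_
  refine Submodule.smul_mem _ _ ?_
  rw [wienerChaos, Submodule.orthogonal_closure, Submodule.mem_orthogonal]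
  have : Submodule.span ℝ {f : Lp ℝ 2 P | ∃ h : H, (q ≠ 0 → ‖h‖ = 1) ∧
    (f : Ω → ℝ) =ᵐ[P] fun ω => Polynomial.aeval (X h ω) (Polynomial.hermite q)}
      ≤ (ℝ ∙ sqLp hX (e i))ᗮ := by
    rw [Submodule.span_le]
    rintro f ⟨h, hh, hf⟩
    rw [SetLike.mem_coe, Submodule.mem_orthogonal_singleton_iff_inner_left, inner_Lp_eq_integral,
      ← hX.integral_hermite_mul_sq_sub_one (g := e i) (hh hq0) hq0 hq]
    refine integral_congr_ae ?_
    filter_upwards [hf, sqLp_coeFn hX (e i)] with ω h1 h2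
    rw [h1, h2, aeval_hermite]
  exact fun u hu => Submodule.mem_orthogonal_singleton_iff_inner_left.1 (this hu)

theorem IsChaosCoeff.pseudoInverse_ae_eq (hX : IsIsonormal X P) (ha : IsChaosCoeff e a) {F : Ω → ℝ}
    (hF : F =ᵐ[P] chaosSum hX e a 0) :
    pseudoInverse X P F =ᵐ[P] chaosSum hX e (fun i => (-(1 / 2)) * a i) 0 := by
  have hm : MemLp F 2 P := (Lp.memLp (chaosSum hX e a 0)).ae_eq hF.symm
  have hL : hm.toLp F = chaosSum hX e a 0 := by
    conv_rhs => rw [← Lp.toLp_coeFn (chaosSum hX e a 0) (Lp.memLp _)]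
    exact (MemLp.toLp_eq_toLp_iff _ _).2 hF
  -- The summation index is shifted by one: index 1 is the second chaos, with weight `1/2`.
  rw [pseudoInverse, dif_pos hm, hL, tsum_eq_single 1]
  · rw [(Submodule.starProjection_eq_self_iff (K := wienerChaos X P (1 + 1))).2
      (ha.chaosSum_mem_wienerChaos hX), ← neg_smul, chaosSum_smul]
    norm_num
  · intro q hq
    have h0 := ha.chaosSum_mem_orthogonal hX (q := q + 1) (by omega) (by omega)
    rw [(Submodule.starProjection_apply_eq_zero_iff (K := wienerChaos X P (q + 1))).2 h0, smul_zero]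

theorem derivSum_smul (hX : IsIsonormal X P) (r : ℝ) :
    derivSum hX e (fun i => r * a i) = r • derivSum hX e a := by
  rw [derivSum, derivSum, ← tsum_const_smul'']
  simp only [smul_smul]
  congr 1; ext1 i; congr 1; ring

variable [TopologicalSpace.SeparableSpace H]

theorem IsChaosCoeff.malliavinDeriv_ae_eq (hX : IsIsonormal X P) (ha : IsChaosCoeff e a) {k : ℝ}
    {F : Ω → ℝ} (hF : F =ᵐ[P] chaosSum hX e a k) :
    malliavinDeriv X P F =ᵐ[P] derivSum hX e a :=
  hX.malliavinDeriv_ae_eq ((ha.isMalliavinDeriv hX k).congr hF.symm)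

/-- As `-L⁻¹F = F/2`, the carré du champ is taken between coefficients `b` and `a/2`, giving `4 b
(a/2)`. The constant is left unspecified: neither derivatives nor variances see it. -/
theorem IsChaosCoeff.gammaOp_succ_ae_eq (hX : IsIsonormal X P) (ha : IsChaosCoeff e a)
    (hb : IsChaosCoeff e b) (hab : IsChaosCoeff e fun i => 2 * b i * a i) {F : Ω → ℝ}
    (hF : F =ᵐ[P] chaosSum hX e a 0) {r : ℕ} {k : ℝ}
    (hr : gammaOp X P r F =ᵐ[P] chaosSum hX e b k) :
    ∃ l, gammaOp X P (r + 1) F =ᵐ[P] chaosSum hX e (fun i => 2 * b i * a i) l := by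
  have ha' : IsChaosCoeff e fun i => (1 / 2) * a i :=
    ha.mono (C := 1 / 2) fun i => by rw [abs_mul]; norm_num
  have ha'' : IsChaosCoeff e fun i => (-(1 / 2)) * a i :=
    ha.mono (C := 1 / 2) fun i => by rw [abs_mul]; norm_num
  have h1 := hb.malliavinDeriv_ae_eq hX hr
  have h2 := ha''.malliavinDeriv_ae_eq hX (ha.pseudoInverse_ae_eq hX hF)
  have e1 : (fun i => 4 * b i * (1 / 2 * a i)) = fun i => 2 * b i * a i := by ext i; ring
  have h3 := hb.inner_derivSum hX ha' (by rwa [e1])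
  rw [e1] at h3
  refine ⟨_, EventuallyEq.trans ?_ h3⟩
  rw [derivSum_smul] at h2
  rw [derivSum_smul]
  filter_upwards [h1, h2, Lp.coeFn_smul (-(1 / 2) : ℝ) (derivSum hX e a),
    Lp.coeFn_smul (1 / 2 : ℝ) (derivSum hX e a)] with ω h1 h2 h4 h5
  simp only [gammaOp]
  rw [h1, h2, h4, h5, Pi.smul_apply, Pi.smul_apply, neg_smul, neg_neg]

theorem IsChaosCoeff.abs_le (ha : IsChaosCoeff e a) : ∃ C, 0 ≤ C ∧ ∀ i, |a i| ≤ C := by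
  refine ⟨√(∑' i, a i ^ 2), Real.sqrt_nonneg _, fun i => Real.abs_le_sqrt ?_⟩
  exact ha.summable.le_tsum i fun j _ => sq_nonneg _

theorem IsChaosCoeff.mul_pow (ha : IsChaosCoeff e a) (r : ℝ) (k : ℕ) :
    IsChaosCoeff e fun i => r * a i ^ (k + 1) := by
  obtain ⟨C, hC, h⟩ := ha.abs_le
  refine ha.mono (C := |r| * C ^ k) fun i => ?_
  rw [abs_mul, pow_succ, abs_mul, abs_pow, mul_assoc]
  gcongr
  exact h i

theorem IsChaosCoeff.gammaOp_ae_eq (hX : IsIsonormal X P) (ha : IsChaosCoeff e a) {F : Ω → ℝ}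
    (hF : F =ᵐ[P] chaosSum hX e a 0) (r : ℕ) :
    ∃ k, gammaOp X P r F =ᵐ[P] chaosSum hX e (fun i => 2 ^ r * a i ^ (r + 1)) k := by
  induction r with
  | zero => exact ⟨0, by simpa [gammaOp] using hF⟩
  | succ r ih =>
    obtain ⟨k, hk⟩ := ih
    have e1 : (fun i => 2 * (2 ^ r * a i ^ (r + 1)) * a i) = fun i => 2 ^ (r + 1) * a i ^ (r + 2) := by
      ext i; ring
    obtain ⟨l, hl⟩ := ha.gammaOp_succ_ae_eq hX (ha.mul_pow (2 ^ r) r)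
      (by rw [e1]; exact ha.mul_pow _ _) hF hk
    rw [e1] at hl
    exact ⟨l, hl⟩

theorem IsChaosCoeff.integral_chaosSum (hX : IsIsonormal X P) (ha : IsChaosCoeff e a) :
    ∫ ω, chaosSum hX e a 0 ω ∂P = 0 := by
  have h1 : ∀ f : Lp ℝ 2 P, ∫ ω, f ω ∂P = ⟪Lp.const 2 P (1 : ℝ), f⟫ := by
    intro f
    rw [inner_Lp_eq_integral]
    refine integral_congr_ae ?_
    filter_upwards [Lp.coeFn_const 2 P (1 : ℝ)] with ω h
    rw [h, Function.const_apply, one_mul]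
  rw [h1]
  have h2 := (ha.tendsto_chaosSum hX (k := 0) (κ := fun _ => 0) tendsto_const_nhds).inner
    (tendsto_const_nhds (x := Lp.const 2 P (1 : ℝ))) (𝕜 := ℝ)
  rw [real_inner_comm] at h2
  refine tendsto_nhds_unique h2 ?_
  refine tendsto_const_nhds.congr fun m => ?_
  rw [map_zero, zero_add, sum_inner]
  refine (Finset.sum_eq_zero fun i _ => ?_).symm
  rw [real_inner_smul_left, real_inner_comm, ← h1]
  by_cases hi : a i = 0
  · simp [hi]
  · rw [integral_sqLp hX (ha.unit i hi), mul_zero]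

theorem IsChaosCoeff.integral_chaosSum_sq (hX : IsIsonormal X P) (ha : IsChaosCoeff e a) :
    ∫ ω, chaosSum hX e a 0 ω ^ 2 ∂P = 2 * ∑' i, a i ^ 2 := by
  simp only [sq (chaosSum hX e a 0 _)]
  rw [← inner_Lp_eq_integral, real_inner_self_eq_norm_sq, chaosSum, map_zero, zero_add,
    norm_tsum_sq_of_pairwise_orthogonal (ha.pairwise_sqLp hX), ← tsum_mul_left]
  · simp only [ha.norm_sq_smul_sqLp hX]
  · simp only [ha.norm_sq_smul_sqLp hX]
    exact ha.summable.mul_left 2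

theorem IsChaosCoeff.variance_chaosSum (hX : IsIsonormal X P) (ha : IsChaosCoeff e a) (k : ℝ) :
    Var[chaosSum hX e a k; P] = 2 * ∑' i, a i ^ 2 := by
  have h1 : chaosSum hX e a k = Lp.const 2 P k + chaosSum hX e a 0 := by
    rw [chaosSum, chaosSum, map_zero, zero_add]
  have h2 : (chaosSum hX e a k : Ω → ℝ) =ᵐ[P] fun ω => k + chaosSum hX e a 0 ω := by
    rw [h1]
    filter_upwards [Lp.coeFn_add (Lp.const 2 P k) (chaosSum hX e a 0), Lp.coeFn_const 2 P k]
      with ω h h'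
    rw [h, Pi.add_apply, h']; rfl
  rw [variance_congr h2, variance_const_add (Lp.aestronglyMeasurable _),
    variance_eq_sub (Lp.memLp _), ha.integral_chaosSum hX]
  simpa using ha.integral_chaosSum_sq hX

theorem IsChaosCoeff.variance_gammaOp_sub (hX : IsIsonormal X P) (ha : IsChaosCoeff e a) {F : Ω → ℝ}
    (hF : F =ᵐ[P] chaosSum hX e a 0) (r : ℕ) :
    Var[fun ω => gammaOp X P (r + 1) F ω - 2 * gammaOp X P r F ω; P]
      = 2 * ∑' i, (2 ^ (r + 1) * a i ^ (r + 2) - 2 * (2 ^ r * a i ^ (r + 1))) ^ 2 := by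
  obtain ⟨k, hk⟩ := ha.gammaOp_ae_eq hX hF (r + 1)
  obtain ⟨l, hl⟩ := ha.gammaOp_ae_eq hX hF r
  have hb := ha.mul_pow (2 ^ (r + 1)) (r + 1)
  have hc : IsChaosCoeff e fun i => 2 * (2 ^ r * a i ^ (r + 1)) := by
    simpa [mul_assoc] using ha.mul_pow (2 * 2 ^ r) r
  have hd : IsChaosCoeff e fun i => 2 ^ (r + 1) * a i ^ (r + 1 + 1) - 2 * (2 ^ r * a i ^ (r + 1)) := by
    obtain ⟨C, hC, h⟩ := ha.abs_le
    refine ha.mono (C := 2 ^ (r + 1) * C ^ r * (C + 1)) fun i => ?_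
    have e1 : 2 ^ (r + 1) * a i ^ (r + 1 + 1) - 2 * (2 ^ r * a i ^ (r + 1))
        = 2 ^ (r + 1) * a i ^ r * (a i - 1) * a i := by ring
    rw [e1, abs_mul, abs_mul, abs_mul, abs_pow, abs_pow]
    have h3 : |a i - 1| ≤ C + 1 := (abs_sub _ _).trans (by simpa using h i)
    gcongr
    · simp
    · exact h i
  rw [← hd.variance_chaosSum hX (k - 2 * l), ← hb.chaosSum_sub hX hc, ← chaosSum_smul]
  refine variance_congr ?_
  filter_upwards [hk, hl, Lp.coeFn_sub (chaosSum hX e (fun i => 2 ^ (r + 1) * a i ^ (r + 1 + 1)) k)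
    ((2 : ℝ) • chaosSum hX e (fun i => 2 ^ r * a i ^ (r + 1)) l), Lp.coeFn_smul (2 : ℝ)
    (chaosSum hX e (fun i => 2 ^ r * a i ^ (r + 1)) l)] with ω h1 h2 h3 h4
  rw [h3, Pi.sub_apply, h4, h1, h2]
  rfl

/-- A random variable which is the `L²` limit of the partial sums is the sum of the series. -/
theorem ae_eq_chaosSum (hX : IsIsonormal X P) (horth : Pairwise fun i j => ⟪e i, e j⟫ = 0)
    (hunit : ∀ i, a i ≠ 0 → ‖e i‖ = 1) {F : Ω → ℝ} (hF : MemLp F 2 P)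
    (hlim : Tendsto (fun m : ℕ => eLpNorm (fun ω => F ω - ∑ i ∈ Finset.range m,
      a i * ((X (e i) ω) ^ 2 - 1)) 2 P) atTop (𝓝 0)) :
    IsChaosCoeff e a ∧ F =ᵐ[P] chaosSum hX e a 0 := by
  have h1 : Tendsto (fun m => ∑ i ∈ Finset.range m, a i • sqLp hX (e i)) atTop
      (𝓝 (hF.toLp F)) := by
    rw [Lp.tendsto_Lp_iff_tendsto_eLpNorm' ]
    refine hlim.congr fun m => ?_
    rw [← eLpNorm_neg]
    refine eLpNorm_congr_ae ?_
    have h0 := chaosPartial_coeFn hX e a 0 m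
    rw [map_zero, zero_add] at h0
    filter_upwards [h0, hF.coeFn_toLp] with ω h2 h3
    rw [Pi.neg_apply, Pi.sub_apply, h2, h3]
    ring
  have horth' : Pairwise fun i j => ⟪a i • sqLp hX (e i), a j • sqLp hX (e j)⟫ = 0 := by
    intro i j hij
    simp only [real_inner_smul_left, real_inner_smul_right]
    by_cases hi : a i = 0
    · simp [hi]
    · rw [inner_sqLp hX (hunit i hi) (horth hij)]; simp
  have hn : ∀ i, ‖a i • sqLp hX (e i)‖ ^ 2 = 2 * a i ^ 2 := by
    intro i
    rw [norm_smul, _root_.mul_pow, Real.norm_eq_abs, sq_abs]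
    by_cases hi : a i = 0
    · simp [hi]
    · rw [norm_sqLp hX (hunit i hi), mul_comm]
  -- The squared norms of the partial sums are `2 ∑ a i ^ 2`. Their convergence yields square
  -- summability, which is not assumed.
  have h2 := h1.norm.pow 2
  simp only [norm_sum_sq_of_pairwise_orthogonal horth', hn, ← Finset.mul_sum] at h2
  have hs : Summable fun i => a i ^ 2 := by
    have h3 := h2.const_mul (1 / 2)
    simp only [← mul_assoc] at h3
    norm_num at h3
    exact ((hasSum_iff_tendsto_nat_of_nonneg (fun i => sq_nonneg _) _).2 h3).summable
  have ha : IsChaosCoeff e a := ⟨horth, hunit, hs⟩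
  refine ⟨ha, ?_⟩
  have h4 : hF.toLp F = chaosSum hX e a 0 := by
    refine tendsto_nhds_unique h1 ?_
    simpa using ha.tendsto_chaosSum hX (k := 0) (κ := fun _ => 0) tendsto_const_nhds
  rw [← h4]
  exact hF.coeFn_toLp.symm

end GammaOperators

/-! ### Convergence of moments from weak convergence and bounded sixth moments. -/

section WeakConvergence

/-- A Fatou lemma for weak convergence, from the portmanteau inequality on open sets. -/
theorem lintegral_sixth_le_of_tendsto {μs : ℕ → ProbabilityMeasure ℝ} {μ : ProbabilityMeasure ℝ}
    (hμ : Tendsto μs atTop (𝓝 μ)) {K : ℝ≥0∞}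
    (hK : ∀ n, ∫⁻ x, ENNReal.ofReal (x ^ 6) ∂(μs n : Measure ℝ) ≤ K) :
    ∫⁻ x, ENNReal.ofReal (x ^ 6) ∂(μ : Measure ℝ) ≤ K := by
  refine (lintegral_le_liminf_lintegral_of_forall_isOpen_measure_le_liminf_measure
    (μs := fun n => (μs n : Measure ℝ)) (f := fun x : ℝ => x ^ 6) (by fun_prop)
    (fun x => by positivity) fun G hG =>
      ProbabilityMeasure.le_liminf_measure_open_of_tendsto hμ hG).trans ?_
  refine (liminf_le_liminf (Eventually.of_forall hK)).trans ?_
  simp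

theorem integrable_of_abs_le_one_add_pow_four {μ : Measure ℝ} [IsProbabilityMeasure μ]
    (h6 : Integrable (fun x : ℝ => x ^ 6) μ) {h : ℝ → ℝ} (hc : Continuous h)
    (hb : ∀ x, |h x| ≤ 1 + x ^ 4) : Integrable h μ := by
  refine ((integrable_const (2 : ℝ)).add h6).mono' hc.aestronglyMeasurable (ae_of_all _ fun x => ?_)
  refine (hb x).trans ?_
  simp only [Pi.add_apply]
  nlinarith [sq_nonneg (x ^ 2 - 1), sq_nonneg x, sq_nonneg (x ^ 3), mul_nonneg (sq_nonneg x)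
    (sq_nonneg (x ^ 2 - 1))]

/-- For `ε > 0`, dividing by `(1 + ε x²)²` makes a function of quartic growth bounded. The relative
error is at most `2 ε x²`, so the absolute error is at most `2 ε (x² + x⁶)`, controlled by the sixth
moment. -/
theorem abs_integral_sub_truncation_le {μ : Measure ℝ} [IsProbabilityMeasure μ]
    (h6 : Integrable (fun x : ℝ => x ^ 6) μ) {K : ℝ} (hK : ∫ x, x ^ 6 ∂μ ≤ K) {h : ℝ → ℝ}
    (hc : Continuous h) (hb : ∀ x, |h x| ≤ 1 + x ^ 4) {ε : ℝ} (hε : 0 ≤ ε) :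
    |∫ x, h x ∂μ - ∫ x, h x / (1 + ε * x ^ 2) ^ 2 ∂μ| ≤ 2 * ε * (1 + 2 * K) := by
  have hpos : ∀ x : ℝ, 0 < 1 + ε * x ^ 2 := fun x => by positivity
  have hc' : Continuous fun x => h x / (1 + ε * x ^ 2) ^ 2 :=
    hc.div (by fun_prop) fun x => (pow_pos (hpos x) 2).ne'
  have hb' : ∀ x, |h x / (1 + ε * x ^ 2) ^ 2| ≤ 1 + x ^ 4 := by
    intro x
    rw [abs_div, abs_of_pos (pow_pos (hpos x) 2)]
    refine (div_le_self (abs_nonneg _) ?_).trans (hb x)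
    have : 0 ≤ ε * x ^ 2 := by positivity
    nlinarith
  have i1 := integrable_of_abs_le_one_add_pow_four h6 hc hb
  have i2 := integrable_of_abs_le_one_add_pow_four h6 hc' hb'
  rw [← integral_sub i1 i2]
  have hbound : ∀ x, ‖h x - h x / (1 + ε * x ^ 2) ^ 2‖ ≤ 2 * ε * (1 + 2 * x ^ 6) := by
    intro x
    set u := ε * x ^ 2 with hu
    have hu0 : 0 ≤ u := by positivity
    have e1 : h x - h x / (1 + u) ^ 2 = h x * (1 - 1 / (1 + u) ^ 2) := by ring
    have h1 : 0 ≤ 1 - 1 / (1 + u) ^ 2 := by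
      rw [sub_nonneg, div_le_one (by positivity)]; nlinarith
    have h2 : 1 - 1 / (1 + u) ^ 2 ≤ 2 * u := by
      rw [sub_le_comm, le_div_iff₀ (by positivity)]
      nlinarith [mul_nonneg hu0 hu0, mul_nonneg hu0 (mul_nonneg hu0 hu0)]
    rw [e1, Real.norm_eq_abs, abs_mul, abs_of_nonneg h1]
    calc _ ≤ (1 + x ^ 4) * (2 * u) := by gcongr; exact hb x
      _ = 2 * ε * (x ^ 2 + x ^ 6) := by rw [hu]; ring
      _ ≤ _ := by
        refine mul_le_mul_of_nonneg_left ?_ (by positivity)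
        nlinarith [sq_nonneg (x ^ 2 - 1), sq_nonneg x, mul_nonneg (sq_nonneg x)
          (sq_nonneg (x ^ 2 - 1))]
  refine (norm_integral_le_of_norm_le (((integrable_const (1 : ℝ)).add (h6.const_mul 2)).const_mul
    (2 * ε)) (ae_of_all _ hbound)).trans ?_
  simp only [Pi.add_apply]
  rw [integral_const_mul, integral_add (integrable_const _) (h6.const_mul 2), integral_const_mul]
  simp only [integral_const, probReal_univ, smul_eq_mul, mul_one]
  gcongr

/-- Weak convergence with bounded sixth moments implies convergence of the integrals of functions
growing at most like `x⁴`. -/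
theorem tendsto_integral_of_sixth_moment_le {μs : ℕ → ProbabilityMeasure ℝ}
    {μ : ProbabilityMeasure ℝ} (hμ : Tendsto μs atTop (𝓝 μ)) {K : ℝ}
    (hi : ∀ n, Integrable (fun x : ℝ => x ^ 6) (μs n : Measure ℝ))
    (hK : ∀ n, ∫ x, x ^ 6 ∂(μs n : Measure ℝ) ≤ K) :
    Integrable (fun x : ℝ => x ^ 6) (μ : Measure ℝ) ∧ ∫ x, x ^ 6 ∂(μ : Measure ℝ) ≤ K ∧
      ∀ h : ℝ → ℝ, Continuous h → (∀ x, |h x| ≤ 1 + x ^ 4) →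
        Tendsto (fun n => ∫ x, h x ∂(μs n : Measure ℝ)) atTop (𝓝 (∫ x, h x ∂(μ : Measure ℝ))) := by
  have hnn : ∀ ρ : Measure ℝ, 0 ≤ᵐ[ρ] fun x : ℝ => x ^ 6 := fun ρ =>
    ae_of_all _ fun x => by positivity
  have hK0 : 0 ≤ K := (integral_nonneg fun x => by positivity).trans (hK 0)
  have hl : ∫⁻ x, ENNReal.ofReal (x ^ 6) ∂(μ : Measure ℝ) ≤ ENNReal.ofReal K := by
    refine lintegral_sixth_le_of_tendsto hμ fun n => ?_
    rw [← ofReal_integral_eq_lintegral_ofReal (hi n) (hnn _)]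
    exact ENNReal.ofReal_le_ofReal (hK n)
  have hiμ : Integrable (fun x : ℝ => x ^ 6) (μ : Measure ℝ) := by
    refine ⟨by fun_prop, ?_⟩
    rw [hasFiniteIntegral_iff_ofReal (hnn _)]
    exact hl.trans_lt ENNReal.ofReal_lt_top
  have hKμ : ∫ x, x ^ 6 ∂(μ : Measure ℝ) ≤ K := by
    rw [← ofReal_integral_eq_lintegral_ofReal hiμ (hnn _)] at hl
    exact (ENNReal.ofReal_le_ofReal_iff hK0).1 hl
  refine ⟨hiμ, hKμ, fun h hc hb => ?_⟩
  rw [Metric.tendsto_atTop]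
  intro δ hδ
  -- Makes each of the two truncation errors at most `δ / 4`; the weak convergence step costs
  -- another `δ / 4`.
  set ε := δ / (8 * (1 + 2 * K)) with hε
  have hε0 : 0 < ε := by positivity
  have hεδ : 2 * ε * (1 + 2 * K) = δ / 4 := by
    rw [hε]; field_simp; norm_num
  have hpos : ∀ x : ℝ, 0 < 1 + ε * x ^ 2 := fun x => by positivity
  let g : BoundedContinuousFunction ℝ ℝ := BoundedContinuousFunction.ofNormedAddCommGroup
    (fun x => h x / (1 + ε * x ^ 2) ^ 2)
    (hc.div (by fun_prop) fun x => (pow_pos (hpos x) 2).ne') (1 + 1 / ε ^ 2) (by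
      intro x
      rw [Real.norm_eq_abs, abs_div, abs_of_pos (pow_pos (hpos x) 2),
        div_le_iff₀ (pow_pos (hpos x) 2)]
      refine (hb x).trans ?_
      have e1 : (1 + 1 / ε ^ 2) * (1 + ε * x ^ 2) ^ 2
          = (1 + ε * x ^ 2) ^ 2 + (1 / ε ^ 2 + 2 * x ^ 2 / ε + x ^ 4) := by
        field_simp
        ring
      rw [e1]
      have : 0 ≤ 1 / ε ^ 2 + 2 * x ^ 2 / ε := by positivity
      have : 0 ≤ ε * x ^ 2 := by positivity
      nlinarith)
  have hg := (ProbabilityMeasure.tendsto_iff_forall_integral_tendsto.1 hμ) g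
  rw [Metric.tendsto_atTop] at hg
  obtain ⟨N, hN⟩ := hg (δ / 4) (by positivity)
  refine ⟨N, fun n hn => ?_⟩
  have h1 := hN n hn
  have h2 := abs_integral_sub_truncation_le (hi n) (hK n) hc hb hε0.le
  have h3 := abs_integral_sub_truncation_le hiμ hKμ hc hb hε0.le
  rw [hεδ] at h2 h3
  rw [Real.dist_eq] at h1 ⊢
  have hgx : ∀ x, g x = h x / (1 + ε * x ^ 2) ^ 2 := fun x => rfl
  simp only [hgx] at h1
  rw [abs_lt] at h1 ⊢
  rw [abs_le] at h2 h3
  constructor <;> linarith [h1.1, h1.2, h2.1, h2.2, h3.1, h3.2]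

theorem tendsto_integral_comp_of_sixth_moment_le {Ω Ω' : Type*} [MeasurableSpace Ω]
    [MeasurableSpace Ω'] {P : Measure Ω} [IsProbabilityMeasure P] {P' : Measure Ω'}
    [IsProbabilityMeasure P'] {Z : ℕ → Ω → ℝ} {G : Ω' → ℝ}
    (hZ : TendstoInDistribution Z atTop G (fun _ => P) P') {K : ℝ}
    (hi : ∀ n, Integrable (fun ω => Z n ω ^ 6) P) (hK : ∀ n, ∫ ω, Z n ω ^ 6 ∂P ≤ K) :
    Integrable (fun ω => G ω ^ 6) P' ∧ ∫ ω, G ω ^ 6 ∂P' ≤ K ∧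
      ∀ h : ℝ → ℝ, Continuous h → (∀ x, |h x| ≤ 1 + x ^ 4) →
        Tendsto (fun n => ∫ ω, h (Z n ω) ∂P) atTop (𝓝 (∫ ω, h (G ω) ∂P')) := by
  have mZ := hZ.forall_aemeasurable
  have mG := hZ.aemeasurable_limit
  have c6 : Continuous fun x : ℝ => x ^ 6 := by fun_prop
  obtain ⟨h1, h2, h3⟩ := tendsto_integral_of_sixth_moment_le hZ.tendsto (K := K)
    (fun n => (integrable_map_measure c6.aestronglyMeasurable (mZ n)).2 (hi n))
    (fun n => by
      simp only [ProbabilityMeasure.coe_mk]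
      rw [integral_map (mZ n) c6.aestronglyMeasurable]
      exact hK n)
  simp only [ProbabilityMeasure.coe_mk] at h1 h2 h3
  refine ⟨(integrable_map_measure c6.aestronglyMeasurable mG).1 h1, ?_, fun h hc hb => ?_⟩
  · rwa [integral_map mG c6.aestronglyMeasurable] at h2
  · have := h3 h hc hb
    rw [integral_map mG hc.aestronglyMeasurable] at this
    refine this.congr fun n => ?_
    rw [integral_map (mZ n) hc.aestronglyMeasurable]

end WeakConvergence

/-! ### Moments of the centered Gamma law. -/

section GammaLaw

theorem integral_pow_gammaMeasure {a : ℝ} (ha : 0 < a) (k : ℕ) :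
    Integrable (fun x : ℝ => x ^ k) (gammaMeasure a 1) ∧
      ∫ x, x ^ k ∂(gammaMeasure a 1) = Real.Gamma (a + k) / Real.Gamma a := by
  have hak : 0 < a + k := by positivity
  have hm : Measurable (gammaPDF a 1) := (measurable_gammaPDFReal a 1).ennreal_ofReal
  have e1 : ∀ x : ℝ, (gammaPDF a 1 x).toReal = gammaPDFReal a 1 x := fun x =>
    ENNReal.toReal_ofReal (gammaPDFReal_nonneg ha one_pos x)
  have e2 : (fun x : ℝ => (gammaPDF a 1 x).toReal • x ^ k)
      =ᵐ[volume] (Set.Ioi (0 : ℝ)).indicator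
        (fun x => (Real.Gamma a)⁻¹ * (Real.exp (-x) * x ^ (a + k - 1))) := by
    -- The origin is discarded: the density is supported on `0 ≤ x`, whereas the Gamma integral and
    -- the addition of real exponents use `0 < x`.
    have h0 : ∀ᵐ x : ℝ, x ≠ 0 := by simp [ae_iff, measure_singleton]
    filter_upwards [h0] with x hx
    rw [e1, gammaPDFReal]
    by_cases h : 0 < x
    · rw [if_pos h.le, Set.indicator_of_mem (Set.mem_Ioi.2 h)]
      have : x ^ (a + k - 1) = x ^ (a - 1) * x ^ k := by
        rw [← Real.rpow_natCast, ← Real.rpow_add h]; congr 1; ring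
      rw [this]
      simp
      ring
    · have h' : x < 0 := lt_of_le_of_ne (not_lt.1 h) hx
      rw [if_neg (not_le.2 h'), Set.indicator_of_notMem (by simpa using h)]
      simp
  have hI : IntegrableOn (fun x : ℝ => (Real.Gamma a)⁻¹ * (Real.exp (-x) * x ^ (a + k - 1)))
      (Set.Ioi 0) := (Real.GammaIntegral_convergent hak).const_mul _
  constructor
  · rw [gammaMeasure, integrable_withDensity_iff_integrable_smul' hm
      (ae_of_all _ fun x => ENNReal.ofReal_lt_top), integrable_congr e2]
    exact (integrable_indicator_iff measurableSet_Ioi).2 hI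
  · rw [gammaMeasure, integral_withDensity_eq_integral_toReal_smul hm
      (ae_of_all _ fun x => ENNReal.ofReal_lt_top), integral_congr_ae e2,
      integral_indicator measurableSet_Ioi, integral_const_mul, ← Real.Gamma_eq_integral hak]
    field_simp

/-- The third and fourth moments of the centered Gamma law. -/
theorem integral_centeredGamma {ν : ℝ} (hν : 0 < ν) :
    ∫ x, x ^ 3 ∂(centeredGamma ν) = 8 * ν ∧
      ∫ x, x ^ 4 ∂(centeredGamma ν) = 12 * ν ^ 2 + 48 * ν := by
  set a := ν / 2 with ha
  have ha0 : 0 < a := by positivity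
  have hν' : ν = 2 * a := by rw [ha]; ring
  have := isProbabilityMeasure_gammaMeasure ha0 one_pos
  have I : ∀ k : ℕ, Integrable (fun x : ℝ => x ^ k) (gammaMeasure a 1) := fun k =>
    (integral_pow_gammaMeasure ha0 k).1
  have G0 : Real.Gamma a ≠ 0 := (Real.Gamma_pos_of_pos ha0).ne'
  have g1 : Real.Gamma (a + 1) = a * Real.Gamma a := Real.Gamma_add_one ha0.ne'
  have g2 : Real.Gamma (a + 2) = (a + 1) * Real.Gamma (a + 1) := by
    rw [← Real.Gamma_add_one (by positivity)]; congr 1; ring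
  have g3 : Real.Gamma (a + 3) = (a + 2) * Real.Gamma (a + 2) := by
    rw [← Real.Gamma_add_one (by positivity)]; congr 1; ring
  have g4 : Real.Gamma (a + 4) = (a + 3) * Real.Gamma (a + 3) := by
    rw [← Real.Gamma_add_one (by positivity)]; congr 1; ring
  have M : ∀ k : ℕ, ∫ x, x ^ k ∂(gammaMeasure a 1) = Real.Gamma (a + k) / Real.Gamma a := fun k =>
    (integral_pow_gammaMeasure ha0 k).2
  have m1 : ∫ x, x ^ 1 ∂(gammaMeasure a 1) = a := by
    rw [M]; push_cast; rw [g1]; field_simp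
  have m2 : ∫ x, x ^ 2 ∂(gammaMeasure a 1) = a * (a + 1) := by
    rw [M]; push_cast; rw [g2, g1]; field_simp
  have m3 : ∫ x, x ^ 3 ∂(gammaMeasure a 1) = a * (a + 1) * (a + 2) := by
    rw [M]; push_cast; rw [g3, g2, g1]; field_simp
  have m4 : ∫ x, x ^ 4 ∂(gammaMeasure a 1) = a * (a + 1) * (a + 2) * (a + 3) := by
    rw [M]; push_cast; rw [g4, g3, g2, g1]; field_simp
  have tr : ∀ k : ℕ, ∫ x, x ^ k ∂(centeredGamma ν)
      = ∫ x, (2 * x - ν) ^ k ∂(gammaMeasure a 1) := fun k => by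
    rw [centeredGamma, integral_map (by fun_prop) (by fun_prop)]
  have i1 := I 1
  have i2 := I 2
  have i3 := I 3
  have i4 := I 4
  constructor
  · rw [tr]
    have e : ∀ x : ℝ, (2 * x - ν) ^ 3 = 8 * x ^ 3 + (-24 * a) * x ^ 2 + (24 * a ^ 2) * x ^ 1
        + (-8 * a ^ 3) := fun x => by rw [hν']; ring
    simp only [e]
    rw [integral_add (by fun_prop) (by fun_prop), integral_add (by fun_prop) (by fun_prop),
      integral_add (by fun_prop) (by fun_prop), integral_const_mul, integral_const_mul,
      integral_const_mul, m1, m2, m3]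
    simp only [integral_const, probReal_univ, smul_eq_mul]
    rw [hν']; ring
  · rw [tr]
    have e : ∀ x : ℝ, (2 * x - ν) ^ 4 = 16 * x ^ 4 + (-64 * a) * x ^ 3 + (96 * a ^ 2) * x ^ 2
        + (-64 * a ^ 3) * x ^ 1 + 16 * a ^ 4 := fun x => by rw [hν']; ring
    simp only [e]
    rw [integral_add (by fun_prop) (by fun_prop), integral_add (by fun_prop) (by fun_prop),
      integral_add (by fun_prop) (by fun_prop), integral_add (by fun_prop) (by fun_prop),
      integral_const_mul, integral_const_mul, integral_const_mul, integral_const_mul, m1, m2, m3, m4]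
    simp only [integral_const, probReal_univ, smul_eq_mul]
    rw [hν']; ring

end GammaLaw

/-! ### Moments of finite diagonal sums. -/

section Moments

theorem memLp_pow_of_forall {Ω : Type*} [MeasurableSpace Ω] {P : Measure Ω} [IsProbabilityMeasure P]
    {f : Ω → ℝ} (hf : ∀ p : ℝ≥0∞, p ≠ ∞ → MemLp f p P) (k : ℕ) {p : ℝ≥0∞} (hp : p ≠ ∞) :
    MemLp (fun ω => f ω ^ k) p P := by
  refine memLp_of_norm_le_pow hf ((hf 1 (by simp)).1.pow k) (C := 1) (k := k) (fun ω => ?_) hp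
  rw [Pi.pow_apply, norm_pow, one_mul]
  gcongr
  simp

/-- Moments of the sum of two independent random variables, the second of which is distributed like
`t (N² - 1)` with `N` standard normal, up to order six. -/
theorem integral_add_pow_of_indep {Ω : Type*} [MeasurableSpace Ω] {P : Measure Ω}
    [IsProbabilityMeasure P] {S Y : Ω → ℝ} (hS : ∀ p : ℝ≥0∞, p ≠ ∞ → MemLp S p P)
    (hY : ∀ p : ℝ≥0∞, p ≠ ∞ → MemLp Y p P) (hind : IndepFun S Y P) {t : ℝ}
    (s1 : ∫ ω, S ω ∂P = 0) (y1 : ∫ ω, Y ω ∂P = 0) (y2 : ∫ ω, Y ω ^ 2 ∂P = 2 * t ^ 2)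
    (y3 : ∫ ω, Y ω ^ 3 ∂P = 8 * t ^ 3) (y4 : ∫ ω, Y ω ^ 4 ∂P = 60 * t ^ 4)
    (y6 : ∫ ω, Y ω ^ 6 ∂P = 6040 * t ^ 6) :
    ∫ ω, (S ω + Y ω) ∂P = 0 ∧
    ∫ ω, (S ω + Y ω) ^ 2 ∂P = ∫ ω, S ω ^ 2 ∂P + 2 * t ^ 2 ∧
    ∫ ω, (S ω + Y ω) ^ 3 ∂P = ∫ ω, S ω ^ 3 ∂P + 8 * t ^ 3 ∧
    ∫ ω, (S ω + Y ω) ^ 4 ∂P = ∫ ω, S ω ^ 4 ∂P + 12 * t ^ 2 * ∫ ω, S ω ^ 2 ∂P + 60 * t ^ 4 ∧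
    ∫ ω, (S ω + Y ω) ^ 6 ∂P = ∫ ω, S ω ^ 6 ∂P + 30 * t ^ 2 * ∫ ω, S ω ^ 4 ∂P
      + 160 * t ^ 3 * ∫ ω, S ω ^ 3 ∂P + 900 * t ^ 4 * ∫ ω, S ω ^ 2 ∂P + 6040 * t ^ 6 := by
  have IS : ∀ k, Integrable (fun ω => S ω ^ k) P := fun k =>
    (memLp_pow_of_forall hS k (p := 1) (by simp)).integrable le_rfl
  have IY : ∀ k, Integrable (fun ω => Y ω ^ k) P := fun k =>
    (memLp_pow_of_forall hY k (p := 1) (by simp)).integrable le_rfl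
  have I : ∀ j k, Integrable (fun ω => S ω ^ j * Y ω ^ k) P := fun j k =>
    (memLp_pow_of_forall hS j (p := 2) (by simp)).integrable_mul
      (memLp_pow_of_forall hY k (p := 2) (by simp))
  have mS : AEMeasurable S P := (hS 1 (by simp)).1.aemeasurable
  have mY : AEMeasurable Y P := (hY 1 (by simp)).1.aemeasurable
  have E : ∀ j k, ∫ ω, S ω ^ j * Y ω ^ k ∂P = (∫ ω, S ω ^ j ∂P) * ∫ ω, Y ω ^ k ∂P := fun j k =>
    hind.integral_fun_comp_mul_comp mS mY (f := fun x => x ^ j) (g := fun x => x ^ k)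
      (by fun_prop) (by fun_prop)
  have s1' : ∫ ω, S ω ^ 1 ∂P = 0 := by simpa using s1
  have y1' : ∫ ω, Y ω ^ 1 ∂P = 0 := by simpa using y1
  have iS1 : Integrable S P := (hS 1 (by simp)).integrable le_rfl
  have iY1 : Integrable Y P := (hY 1 (by simp)).integrable le_rfl
  refine ⟨?_, ?_, ?_, ?_, ?_⟩
  · rw [integral_add iS1 iY1, s1, y1, add_zero]
  · have e : ∀ ω, (S ω + Y ω) ^ 2 = S ω ^ 2 + 2 * (S ω ^ 1 * Y ω ^ 1) + Y ω ^ 2 := fun ω => by ring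
    simp only [e]
    rw [integral_add (by fun_prop) (by fun_prop), integral_add (by fun_prop) (by fun_prop),
      integral_const_mul, E, y2, y1']
    ring
  · have e : ∀ ω, (S ω + Y ω) ^ 3 = S ω ^ 3 + 3 * (S ω ^ 2 * Y ω ^ 1) + 3 * (S ω ^ 1 * Y ω ^ 2)
        + Y ω ^ 3 := fun ω => by ring
    simp only [e]
    rw [integral_add (by fun_prop) (by fun_prop), integral_add (by fun_prop) (by fun_prop),
      integral_add (by fun_prop) (by fun_prop), integral_const_mul, integral_const_mul, E, E,
      y3, y2, y1', s1']
    ring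
  · have e : ∀ ω, (S ω + Y ω) ^ 4 = S ω ^ 4 + 4 * (S ω ^ 3 * Y ω ^ 1) + 6 * (S ω ^ 2 * Y ω ^ 2)
        + 4 * (S ω ^ 1 * Y ω ^ 3) + Y ω ^ 4 := fun ω => by ring
    simp only [e]
    rw [integral_add (by fun_prop) (by fun_prop), integral_add (by fun_prop) (by fun_prop),
      integral_add (by fun_prop) (by fun_prop), integral_add (by fun_prop) (by fun_prop),
      integral_const_mul, integral_const_mul, integral_const_mul, E, E, E, y4, y3, y2, y1', s1']
    ring
  · have e : ∀ ω, (S ω + Y ω) ^ 6 = S ω ^ 6 + 6 * (S ω ^ 5 * Y ω ^ 1) + 15 * (S ω ^ 4 * Y ω ^ 2)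
        + 20 * (S ω ^ 3 * Y ω ^ 3) + 15 * (S ω ^ 2 * Y ω ^ 4) + 6 * (S ω ^ 1 * Y ω ^ 5)
        + Y ω ^ 6 := fun ω => by ring
    simp only [e]
    rw [integral_add (by fun_prop) (by fun_prop), integral_add (by fun_prop) (by fun_prop),
      integral_add (by fun_prop) (by fun_prop), integral_add (by fun_prop) (by fun_prop),
      integral_add (by fun_prop) (by fun_prop), integral_add (by fun_prop) (by fun_prop),
      integral_const_mul, integral_const_mul, integral_const_mul, integral_const_mul,
      integral_const_mul, E, E, E, E, E, y6, y4, y3, y2, y1', s1']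
    ring

/-- Induction step for an elementary form of hypercontractivity: the sixth moment is at most a
constant times the cube of the variance, with the constant 6040 dictated by a single term. The
bounds on the power sums `q3` and `q4` are carried along because the mixed terms need them. -/
theorem moment_bounds_add {q2 q3 q4 s6 : ℝ} (q2nn : 0 ≤ q2) (hq3 : q3 ^ 2 ≤ q2 ^ 3)
    (hq4 : q4 ≤ q2 ^ 2) (h6 : s6 ≤ 6040 * q2 ^ 3) (t : ℝ) :
    (q3 + t ^ 3) ^ 2 ≤ (q2 + t ^ 2) ^ 3 ∧ q4 + t ^ 4 ≤ (q2 + t ^ 2) ^ 2 ∧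
    s6 + 30 * t ^ 2 * (12 * q2 ^ 2 + 48 * q4) + 160 * t ^ 3 * (8 * q3) + 900 * t ^ 4 * (2 * q2)
      + 6040 * t ^ 6 ≤ 6040 * (q2 + t ^ 2) ^ 3 := by
  have p1 : 0 ≤ q2 * t ^ 4 := by positivity
  have p2 : 0 ≤ q2 ^ 2 * t ^ 2 := by positivity
  have p3 : 0 ≤ q2 * t ^ 2 := by positivity
  have p4 : q4 * t ^ 2 ≤ q2 ^ 2 * t ^ 2 := by gcongr
  -- Arithmetic-geometric mean inequality, after bounding `|q3|` by `q2 ^ (3/2)`.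
  have hcross : 2 * (q3 * t ^ 3) ≤ q2 ^ 2 * t ^ 2 + q2 * t ^ 4 := by
    refine abs_le_of_sq_le_sq' ?_ (add_nonneg p2 p1) |>.2
    have h5 : q3 ^ 2 * t ^ 6 ≤ q2 ^ 3 * t ^ 6 := by gcongr
    calc (2 * (q3 * t ^ 3)) ^ 2 = 4 * (q3 ^ 2 * t ^ 6) := by ring
      _ ≤ 4 * (q2 ^ 3 * t ^ 6) := by linarith
      _ = (q2 ^ 2 * t ^ 2 + q2 * t ^ 4) ^ 2 - (q2 ^ 2 * t ^ 2 - q2 * t ^ 4) ^ 2 := by ring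
      _ ≤ _ := by linarith [sq_nonneg (q2 ^ 2 * t ^ 2 - q2 * t ^ 4)]
  have e3 : (q2 + t ^ 2) ^ 3 = q2 ^ 3 + 3 * (q2 ^ 2 * t ^ 2) + 3 * (q2 * t ^ 4) + t ^ 6 := by ring
  refine ⟨?_, ?_, ?_⟩
  · have e' : (q3 + t ^ 3) ^ 2 = q3 ^ 2 + 2 * (q3 * t ^ 3) + t ^ 6 := by ring
    rw [e3, e']
    linarith
  · have e' : (q2 + t ^ 2) ^ 2 = q2 ^ 2 + 2 * (q2 * t ^ 2) + t ^ 4 := by ring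
    rw [e']
    linarith
  · have e' : s6 + 30 * t ^ 2 * (12 * q2 ^ 2 + 48 * q4) + 160 * t ^ 3 * (8 * q3)
        + 900 * t ^ 4 * (2 * q2) + 6040 * t ^ 6 = s6 + 360 * (q2 ^ 2 * t ^ 2) + 1440 * (q4 * t ^ 2)
          + 1280 * (q3 * t ^ 3) + 1800 * (q2 * t ^ 4) + 6040 * t ^ 6 := by ring
    rw [e3, e']
    linarith

variable {H Ω : Type*} [NormedAddCommGroup H] [InnerProductSpace ℝ H] [CompleteSpace H]
  [MeasurableSpace Ω] {P : Measure Ω} [IsProbabilityMeasure P] {X : H → Ω → ℝ}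
  {e : ℕ → H} {a : ℕ → ℝ}

theorem IsIsonormal.memLp_partialSum (hX : IsIsonormal X P) (e : ℕ → H) (a : ℕ → ℝ) (m : ℕ)
    {p : ℝ≥0∞} (hp : p ≠ ∞) :
    MemLp (fun ω => ∑ i ∈ Finset.range m, a i * ((X (e i) ω) ^ 2 - 1)) p P :=
  memLp_finsetSum _ fun i _ => (hX.memLp_sq_sub_one (e i) hp).const_mul (a i)

theorem IsIsonormal.indepFun_partialSum (hX : IsIsonormal X P)
    (horth : Pairwise fun i j => ⟪e i, e j⟫ = 0) (a : ℕ → ℝ) (m : ℕ) :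
    IndepFun (fun ω => ∑ i ∈ Finset.range m, a i * ((X (e i) ω) ^ 2 - 1))
      (fun ω => a m * ((X (e m) ω) ^ 2 - 1)) P := by
  have h1 : IndepFun (fun ω (i : Fin m) => X (e i) ω) (fun ω (_ : Unit) => X (e m) ω) P := by
    refine IsGaussianProcess.indepFun_of_covariance_eq_zero (X := fun i : Fin m => X (e i))
      (Y := fun _ => X (e m)) ?_
      (fun i => hX.aemeasurable _) (fun _ => hX.aemeasurable _) ?_
    · have := hX.isGaussianProcess.comp_right
        (Sum.elim (fun i : Fin m => e i) (fun _ : Unit => e m))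
      convert! this using 1
      ext (i | i) <;> rfl
    · intro i _
      rw [hX.cov]
      exact horth i.2.ne
  have h2 := h1.comp (φ := fun x : Fin m → ℝ => ∑ i : Fin m, a i * (x i ^ 2 - 1))
    (ψ := fun x : Unit → ℝ => a m * (x () ^ 2 - 1)) (by fun_prop) (by fun_prop)
  refine h2.congr (ae_of_all _ fun ω => ?_) (ae_of_all _ fun ω => rfl)
  simp only [Function.comp_apply, Finset.sum_range]

/-- Moments of a finite sum `∑ i < m, a i (X(e i)² - 1)`. -/
theorem IsIsonormal.moments_partialSum (hX : IsIsonormal X P)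
    (horth : Pairwise fun i j => ⟪e i, e j⟫ = 0) (hunit : ∀ i, a i ≠ 0 → ‖e i‖ = 1) (m : ℕ) :
    ∫ ω, (∑ i ∈ Finset.range m, a i * ((X (e i) ω) ^ 2 - 1)) ∂P = 0 ∧
    ∫ ω, (∑ i ∈ Finset.range m, a i * ((X (e i) ω) ^ 2 - 1)) ^ 2 ∂P
      = 2 * ∑ i ∈ Finset.range m, a i ^ 2 ∧
    ∫ ω, (∑ i ∈ Finset.range m, a i * ((X (e i) ω) ^ 2 - 1)) ^ 3 ∂P
      = 8 * ∑ i ∈ Finset.range m, a i ^ 3 ∧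
    ∫ ω, (∑ i ∈ Finset.range m, a i * ((X (e i) ω) ^ 2 - 1)) ^ 4 ∂P
      = 12 * (∑ i ∈ Finset.range m, a i ^ 2) ^ 2 + 48 * ∑ i ∈ Finset.range m, a i ^ 4 ∧
    (∑ i ∈ Finset.range m, a i ^ 3) ^ 2 ≤ (∑ i ∈ Finset.range m, a i ^ 2) ^ 3 ∧
    (∑ i ∈ Finset.range m, a i ^ 4) ≤ (∑ i ∈ Finset.range m, a i ^ 2) ^ 2 ∧
    ∫ ω, (∑ i ∈ Finset.range m, a i * ((X (e i) ω) ^ 2 - 1)) ^ 6 ∂P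
      ≤ 6040 * (∑ i ∈ Finset.range m, a i ^ 2) ^ 3 := by
  induction m with
  | zero => simp
  | succ m ih =>
    obtain ⟨h1, h2, h3, h4, hq3, hq4, h6⟩ := ih
    set q2 := ∑ i ∈ Finset.range m, a i ^ 2 with hq2
    set q3 := ∑ i ∈ Finset.range m, a i ^ 3
    set q4 := ∑ i ∈ Finset.range m, a i ^ 4
    have q2nn : 0 ≤ q2 := Finset.sum_nonneg fun i _ => sq_nonneg _
    simp only [Finset.sum_range_succ]
    set t := a m with ht
    -- The exponent is positive so that both sides vanish for `t = 0`, where `e m` need not be a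
    -- unit vector.
    have hy : ∀ k : ℕ, ∫ ω, (t * ((X (e m) ω) ^ 2 - 1)) ^ (k + 1) ∂P
        = t ^ (k + 1) * ∫ x : ℝ, (x ^ 2 - 1) ^ (k + 1) ∂(gaussianReal 0 1) := by
      intro k
      by_cases h0 : t = 0
      · simp [h0]
      · rw [← hX.integral_comp_of_norm_eq_one (hunit m h0) (f := fun x => (x ^ 2 - 1) ^ (k + 1))
          (by fun_prop), ← integral_const_mul]
        refine integral_congr_ae (ae_of_all _ fun ω => ?_)
        simp only [mul_pow]
    obtain ⟨g1, g2, g3, g4, g6⟩ := integral_sq_sub_one_pow_gaussian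
    have y1 := hy 0
    simp only [zero_add, pow_one, g1, mul_zero] at y1
    have y2 := hy 1
    have y3 := hy 2
    have y4 := hy 3
    have y6 := hy 5
    norm_num at y2 y3 y4 y6
    rw [g2, mul_comm] at y2
    rw [g3, mul_comm] at y3
    rw [g4, mul_comm] at y4
    rw [g6, mul_comm] at y6
    obtain ⟨r1, r2, r3, r4, r6⟩ := integral_add_pow_of_indep
      (fun p hp => hX.memLp_partialSum e a m hp)
      (fun p hp => (hX.memLp_sq_sub_one (e m) hp).const_mul (a m))
      (hX.indepFun_partialSum horth a m) h1 y1 y2 y3 y4 y6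
    rw [h2] at r2 r4 r6
    rw [h3] at r3 r6
    rw [h4] at r4 r6
    refine ⟨r1, by rw [r2]; ring, by rw [r3]; ring, by rw [r4]; ring, ?_⟩
    rw [r6]
    exact moment_bounds_add q2nn hq3 hq4 h6 t

end Moments

/-! ### Moments of infinite sums and convergence of the power sums. -/

section Limit

variable {H Ω : Type*} [NormedAddCommGroup H] [InnerProductSpace ℝ H] [CompleteSpace H]
  [MeasurableSpace Ω] {P : Measure Ω} [IsProbabilityMeasure P] {X : H → Ω → ℝ}
  {e : ℕ → H} {a : ℕ → ℝ}

theorem abs_pow_le_one_add_pow_four (x : ℝ) : |x ^ 3| ≤ 1 + x ^ 4 ∧ |x ^ 4| ≤ 1 + x ^ 4 := by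
  constructor
  · rw [abs_le]
    constructor <;> nlinarith [sq_nonneg (x ^ 2 - x), sq_nonneg (x ^ 2 + x), sq_nonneg (x ^ 2 - 1),
      sq_nonneg (x - 1), sq_nonneg (x + 1)]
  · rw [abs_of_nonneg (by positivity)]; linarith

theorem summable_pow_of_summable_sq (ha : Summable fun i => a i ^ 2) (k : ℕ) :
    Summable fun i => a i ^ (k + 2) := by
  have h0 := ha.tendsto_cofinite_zero
  have h1 : ∀ᶠ i in cofinite, a i ^ 2 < 1 := h0.eventually (gt_mem_nhds one_pos)
  refine Summable.of_norm_bounded_eventually ha (h1.mono fun i hi => ?_)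
  have h2 : |a i| ≤ 1 := by
    rw [← sq_abs] at hi
    nlinarith [abs_nonneg (a i)]
  rw [pow_add, norm_mul, norm_pow, Real.norm_eq_abs, Real.norm_of_nonneg (sq_nonneg _)]
  exact mul_le_of_le_one_left (sq_nonneg _) (pow_le_one₀ (abs_nonneg _) h2)

/-- Moments of an element of the second chaos. -/
theorem IsChaosCoeff.moments (hX : IsIsonormal X P) (ha : IsChaosCoeff e a) {F : Ω → ℝ}
    (hF : F =ᵐ[P] chaosSum hX e a 0) :
    Integrable (fun ω => F ω ^ 6) P ∧ ∫ ω, F ω ^ 6 ∂P ≤ 6040 * (∑' i, a i ^ 2) ^ 3 ∧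
    ∫ ω, F ω ^ 3 ∂P = 8 * ∑' i, a i ^ 3 ∧
    ∫ ω, F ω ^ 4 ∂P = 12 * (∑' i, a i ^ 2) ^ 2 + 48 * ∑' i, a i ^ 4 := by
  set S : ℕ → Ω → ℝ := fun m ω => ∑ i ∈ Finset.range m, a i * ((X (e i) ω) ^ 2 - 1) with hS
  have hmom := hX.moments_partialSum ha.orth ha.unit
  have hle : ∀ m, ∑ i ∈ Finset.range m, a i ^ 2 ≤ ∑' i, a i ^ 2 := fun m =>
    ha.summable.sum_le_tsum _ fun i _ => sq_nonneg _
  -- The lemma on weak convergence serves a first time here, to carry moments from partial sums to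
  -- `F`. The sixth-moment bound obtained depends only on `∑ a i ^ 2`, hence will be uniform in `n`.
  have hdist : TendstoInDistribution S atTop F (fun _ => P) P := by
    have h1 := tendstoInMeasure_Lp
      (ha.tendsto_chaosSum hX (k := 0) (κ := fun _ => 0) tendsto_const_nhds)
    refine TendstoInMeasure.tendstoInDistribution ?_
      (fun m => (hX.memLp_partialSum e a m (p := 1) (by simp)).1.aemeasurable)
    refine h1.congr (fun m => ?_) hF.symm
    filter_upwards [chaosPartial_coeFn hX e a 0 m] with ω h
    rw [h, zero_add]
  obtain ⟨h1, h2, h3⟩ := tendsto_integral_comp_of_sixth_moment_le hdist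
    (K := 6040 * (∑' i, a i ^ 2) ^ 3)
    (fun m => (memLp_pow_of_forall (fun p hp => hX.memLp_partialSum e a m hp) 6
      (p := 1) (by simp)).integrable le_rfl)
    (fun m => (hmom m).2.2.2.2.2.2.trans 
      (mul_le_mul_of_nonneg_left (pow_le_pow_left₀
        (Finset.sum_nonneg fun i _ => sq_nonneg (a i)) (hle m) 3) (by norm_num)))
  refine ⟨h1, h2, ?_, ?_⟩
  · have t1 := h3 (fun x => x ^ 3) (by fun_prop) fun x => (abs_pow_le_one_add_pow_four x).1
    refine tendsto_nhds_unique t1 ?_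
    simp only [hS, fun m => (hmom m).2.2.1]
    exact (summable_pow_of_summable_sq ha.summable 1).hasSum.tendsto_sum_nat.const_mul 8
  · have t1 := h3 (fun x => x ^ 4) (by fun_prop) fun x => (abs_pow_le_one_add_pow_four x).2
    refine tendsto_nhds_unique t1 ?_
    simp only [hS, fun m => (hmom m).2.2.2.1]
    exact ((ha.summable.hasSum.tendsto_sum_nat.pow 2).const_mul 12).add
      ((summable_pow_of_summable_sq ha.summable 2).hasSum.tendsto_sum_nat.const_mul 48)

/-- Convergence to the centered Gamma law forces the power sums of order three and four of the
coefficients to converge. -/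
theorem tendsto_powerSums {Ω' : Type*} [MeasurableSpace Ω'] {P' : Measure Ω'}
    [IsProbabilityMeasure P'] (hX : IsIsonormal X P) {ν : ℝ} (hν : 0 < ν) {G : Ω' → ℝ}
    (hG : HasLaw G (centeredGamma ν) P') {e : ℕ → ℕ → H} {c : ℕ → ℕ → ℝ} {F : ℕ → Ω → ℝ}
    (hc : ∀ n, IsChaosCoeff (e n) (c n)) (hF : ∀ n, F n =ᵐ[P] chaosSum hX (e n) (c n) 0)
    (hsq : ∀ n, ∑' i, c n i ^ 2 = ν)
    (hlim : TendstoInDistribution F atTop G (fun _ => P) P') :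
    Tendsto (fun n => ∑' i, c n i ^ 3) atTop (𝓝 ν) ∧
      Tendsto (fun n => ∑' i, c n i ^ 4) atTop (𝓝 ν) := by
  have hm := fun n => (hc n).moments hX (hF n)
  simp only [hsq] at hm
  obtain ⟨-, -, h3⟩ := tendsto_integral_comp_of_sixth_moment_le hlim
    (K := 6040 * ν ^ 3) (fun n => (hm n).1) (fun n => (hm n).2.1)
  have tr : ∀ k : ℕ, ∫ ω, G ω ^ k ∂P' = ∫ x, x ^ k ∂(centeredGamma ν) := fun k => by
    rw [← hG.map_eq, integral_map hG.aemeasurable (by fun_prop)]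
  obtain ⟨g3, g4⟩ := integral_centeredGamma hν
  constructor
  · have t1 := h3 (fun x => x ^ 3) (by fun_prop) fun x => (abs_pow_le_one_add_pow_four x).1
    simp only [fun n => (hm n).2.2.1, tr, g3] at t1
    have t2 := t1.const_mul (1 / 8)
    convert! t2 using 2 <;> ring
  · have t1 := h3 (fun x => x ^ 4) (by fun_prop) fun x => (abs_pow_le_one_add_pow_four x).2
    simp only [fun n => (hm n).2.2.2, tr, g4] at t1
    have t2 := (t1.sub_const (12 * ν ^ 2)).const_mul (1 / 48)
    convert! t2 using 2 <;> ring

end Limit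

/-! ### A single coefficient sequence: separating values near 1 from values near 0. -/

section Coefficients

variable {c : ℕ → ℝ}

/-- With its companion below, a dichotomy at the threshold `1/2`: smallness of `x²(x-1)²` forces `x`
to be near 0 or near 1. -/
theorem sq_le_four_mul {x : ℝ} (hx : |x| ≤ 1 / 2) : x ^ 2 ≤ 4 * (x ^ 2 * (x - 1) ^ 2) := by
  rw [abs_le] at hx
  have : 1 ≤ 4 * (x - 1) ^ 2 := by nlinarith
  nlinarith [sq_nonneg x]

theorem sub_one_sq_le_four_mul {x : ℝ} (hx : 1 / 2 ≤ |x|) :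
    (x - 1) ^ 2 ≤ 4 * (x ^ 2 * (x - 1) ^ 2) := by
  have : 1 ≤ 4 * x ^ 2 := by rw [← sq_abs]; nlinarith
  nlinarith [sq_nonneg (x - 1)]

theorem summable_pow_mul_sub_one_sq (hs : Summable fun i => c i ^ 2) (k : ℕ) :
    Summable fun i => c i ^ (k + 2) * (c i - 1) ^ 2 := by
  refine (((summable_pow_of_summable_sq hs (k + 2)).sub
    ((summable_pow_of_summable_sq hs (k + 1)).mul_left 2)).add
    (summable_pow_of_summable_sq hs k)).congr fun i => ?_
  ring

theorem tsum_sq_mul_sub_one_sq (hs : Summable fun i => c i ^ 2) :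
    ∑' i, c i ^ 2 * (c i - 1) ^ 2 = ∑' i, c i ^ 4 - 2 * ∑' i, c i ^ 3 + ∑' i, c i ^ 2 := by
  rw [← tsum_mul_left, ← (summable_pow_of_summable_sq hs 2).tsum_sub
    ((summable_pow_of_summable_sq hs 1).mul_left 2), ← Summable.tsum_add
    ((summable_pow_of_summable_sq hs 2).sub ((summable_pow_of_summable_sq hs 1).mul_left 2)) hs]
  congr 1; ext i; ring

theorem thetaRate_eq (c : ℕ → ℝ) (d : ℕ) : thetaRate c d = ∑' i, c (i + d) ^ 2 := by
  simp only [thetaRate, add_comm]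

/-- The witness is the first index with `|c k| ≤ 1/2`; by monotonicity everything after it is small
too. Each earlier square exceeds `1/4`, which bounds `k`. -/
theorem exists_index_split (hs : Summable fun i => c i ^ 2) (ha : Antitone fun i => |c i|) :
    ∃ k : ℕ, (∀ i < k, (c i - 1) ^ 2 ≤ 4 * ∑' i, c i ^ 2 * (c i - 1) ^ 2) ∧
      thetaRate c k ≤ 4 * ∑' i, c i ^ 2 * (c i - 1) ^ 2 ∧ (k : ℝ) ≤ 4 * ∑' i, c i ^ 2 := by
  have hq := summable_pow_mul_sub_one_sq hs 0
  simp only [zero_add] at hq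
  have hex : ∃ k, |c k| ≤ 1 / 2 := by
    have h0 := hs.tendsto_atTop_zero
    obtain ⟨k, hk⟩ := (h0.eventually (gt_mem_nhds (show (0 : ℝ) < 1 / 4 by norm_num))).exists
    refine ⟨k, abs_le_of_sq_le_sq (by linarith) (by norm_num)⟩
  classical
  refine ⟨Nat.find hex, fun i hi => ?_, ?_, ?_⟩
  · have h1 := Nat.find_min hex hi
    refine (sub_one_sq_le_four_mul (not_le.1 h1).le).trans ?_
    gcongr
    exact hq.le_tsum i fun j _ => by positivity
  · rw [thetaRate_eq, ← tsum_mul_left]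
    have h1 : ∀ i, c (i + Nat.find hex) ^ 2
        ≤ 4 * (c (i + Nat.find hex) ^ 2 * (c (i + Nat.find hex) - 1) ^ 2) := fun i =>
      sq_le_four_mul ((ha (Nat.le_add_left _ i)).trans (Nat.find_spec hex))
    refine (Summable.tsum_le_tsum h1 ((summable_nat_add_iff _).2 hs)
      ((summable_nat_add_iff (f := fun i => 4 * (c i ^ 2 * (c i - 1) ^ 2)) _).2
        (hq.mul_left 4))).trans ?_
    rw [← (hq.mul_left 4).sum_add_tsum_nat_add (Nat.find hex)]
    exact le_add_of_nonneg_left (Finset.sum_nonneg fun i _ => by positivity)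
  · have h1 : ∑ i ∈ Finset.range (Nat.find hex), (1 / 4 : ℝ) ≤ ∑' i, c i ^ 2 := by
      refine (Finset.sum_le_sum fun i hi => ?_).trans
        (hs.sum_le_tsum (Finset.range (Nat.find hex)) fun i _ => sq_nonneg _)
      have := not_le.1 (Nat.find_min hex (Finset.mem_range.1 hi))
      rw [← sq_abs]
      nlinarith
    rw [Finset.sum_const, Finset.card_range, nsmul_eq_mul] at h1
    linarith

/-- If the first `k` coefficients are near 1 and the tail is small, the total sum of squares is
nearly `k`; this is what forces `ν` to be an integer. -/
theorem abs_tsum_sub_le (hs : Summable fun i => c i ^ 2) {k : ℕ} {δ : ℝ} (hδ : 0 ≤ δ)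
    (h1 : ∀ i < k, (c i - 1) ^ 2 ≤ δ ^ 2) :
    |∑' i, c i ^ 2 - k| ≤ k * (δ * (2 + δ)) + thetaRate c k := by
  have h0 : 0 ≤ thetaRate c k := tsum_nonneg fun i => sq_nonneg _
  have e1 : ∑' i, c i ^ 2 - k = ∑ i ∈ Finset.range k, (c i ^ 2 - 1) + thetaRate c k := by
    rw [thetaRate_eq, ← hs.sum_add_tsum_nat_add k, Finset.sum_sub_distrib]
    simp; ring
  rw [e1]
  refine (abs_add_le _ _).trans ?_
  rw [abs_of_nonneg h0]
  gcongr
  refine (Finset.abs_sum_le_sum_abs _ _).trans ?_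
  have h2 : ∀ i ∈ Finset.range k, |c i ^ 2 - 1| ≤ δ * (2 + δ) := by
    intro i hi
    have h3 := abs_le_of_sq_le_sq (h1 i (Finset.mem_range.1 hi)) hδ
    have e2 : c i ^ 2 - 1 = (c i - 1) * (2 + (c i - 1)) := by ring
    rw [e2, abs_mul]
    have h4 : |2 + (c i - 1)| ≤ 2 + δ := (abs_add_le _ _).trans (by simpa using h3)
    gcongr
  refine (Finset.sum_le_sum h2).trans ?_
  rw [Finset.sum_const, Finset.card_range, nsmul_eq_mul]

end Coefficients

/-! ### Integrality of the parameter. -/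

section Asymptotics

variable {c : ℕ → ℕ → ℝ} {ν : ℝ}

/-- If `∑ c_i² (c_i - 1)² → 0` with `∑ c_i² = ν`, then `ν` is an integer `d`, the first `d`
coefficients tend to one and the others tend to zero in `ℓ²`. -/
theorem exists_nat_eq_of_tendsto (hs : ∀ n, Summable fun i => c n i ^ 2)
    (ha : ∀ n, Antitone fun i => |c n i|) (hν : ∀ n, ∑' i, c n i ^ 2 = ν)
    (hlim : Tendsto (fun n => ∑' i, c n i ^ 2 * (c n i - 1) ^ 2) atTop (𝓝 0)) :
    ∃ d : ℕ, (d : ℝ) = ν ∧ ∀ᶠ n in atTop,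
      (∀ i < d, (c n i - 1) ^ 2 ≤ 4 * ∑' i, c n i ^ 2 * (c n i - 1) ^ 2) ∧
      thetaRate (c n) d ≤ 4 * ∑' i, c n i ^ 2 * (c n i - 1) ^ 2 := by
  choose k hk1 hk2 hk3 using fun n => exists_index_split (hs n) (ha n)
  set ε : ℕ → ℝ := fun n => ∑' i, c n i ^ 2 * (c n i - 1) ^ 2 with hε
  have hε0 : ∀ n, 0 ≤ ε n := fun n => tsum_nonneg fun i => by positivity
  set δ : ℕ → ℝ := fun n => √(4 * ε n) with hδ
  have hδsq : ∀ n, δ n ^ 2 = 4 * ε n := fun n => Real.sq_sqrt (by have := hε0 n; positivity)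
  have hδ0 : Tendsto δ atTop (𝓝 0) := by
    have := (hlim.const_mul 4).sqrt
    simpa [hδ] using this
  -- The factor `k n` in the error is replaced by its uniform bound `4 ν`, so the right side tends
  -- to zero.
  have hbound : ∀ n, |(k n : ℝ) - ν| ≤ 4 * ν * (δ n * (2 + δ n)) + 4 * ε n := by
    intro n
    have h1 := abs_tsum_sub_le (hs n) (δ := δ n) (Real.sqrt_nonneg _) (k := k n)
      (fun i hi => by rw [hδsq]; exact hk1 n i hi)
    rw [hν] at h1
    rw [abs_sub_comm]
    refine h1.trans (add_le_add (mul_le_mul_of_nonneg_right ?_ ?_) (hk2 n))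
    · have := hk3 n
      rwa [hν] at this
    · have : 0 ≤ δ n := Real.sqrt_nonneg _
      positivity
  have hk : Tendsto (fun n => (k n : ℝ)) atTop (𝓝 ν) := by
    rw [tendsto_iff_dist_tendsto_zero]
    refine squeeze_zero (fun n => dist_nonneg) (fun n => ?_)
      (g := fun n => 4 * ν * (δ n * (2 + δ n)) + 4 * ε n) ?_
    · rw [Real.dist_eq]; exact hbound n
    · have := ((hδ0.mul (hδ0.const_add 2)).const_mul (4 * ν)).add (hlim.const_mul 4)
      simpa using this
  -- The natural numbers are closed in the reals, and a convergent sequence of them is eventually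
  -- constant.
  obtain ⟨d, hd⟩ := Nat.isClosedEmbedding_coe_real.isClosed_range.mem_of_tendsto hk
    (Eventually.of_forall fun n => Set.mem_range_self _)
  refine ⟨d, hd, ?_⟩
  have h1 : ∀ᶠ n in atTop, k n = d := by
    rw [← hd] at hk
    filter_upwards [Metric.tendsto_nhds.1 hk 1 one_pos] with n hn
    rw [Real.dist_eq] at hn
    have h2 : |((k n : ℤ) - d : ℤ)| < 1 := by exact_mod_cast hn
    have := Int.abs_lt_one_iff.1 h2
    omega
  filter_upwards [h1] with n hn
  rw [← hn]
  exact ⟨hk1 n, hk2 n⟩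

end Asymptotics

/-! ### Bounds for the weighted sums in terms of `ω` and `ϑ`. -/

section Rates

variable {c : ℕ → ℝ} {d : ℕ}

theorem thetaRate_nonneg (c : ℕ → ℝ) (d : ℕ) : 0 ≤ thetaRate c d :=
  tsum_nonneg fun _ => sq_nonneg _

theorem omegaRate_nonneg (c : ℕ → ℝ) (d : ℕ) : 0 ≤ omegaRate c d :=
  Real.iSup_nonneg fun _ => abs_nonneg _

theorem abs_sub_one_le_omegaRate {i : ℕ} (hi : i < d) : |c i - 1| ≤ omegaRate c d := by
  rw [abs_sub_comm]
  exact le_ciSup (f := fun i : Fin d => |1 - c i|) (Set.finite_range _).bddAbove ⟨i, hi⟩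

theorem exists_omegaRate_eq (hd : 0 < d) : ∃ i < d, omegaRate c d = |c i - 1| := by
  have : Nonempty (Fin d) := ⟨⟨0, hd⟩⟩
  obtain ⟨i, hi⟩ := exists_eq_ciSup_of_finite (f := fun i : Fin d => |1 - c i|)
  exact ⟨i, i.2, by rw [abs_sub_comm, hi]; rfl⟩

theorem sq_le_thetaRate (hs : Summable fun i => c i ^ 2) {i : ℕ} (hi : d ≤ i) :
    c i ^ 2 ≤ thetaRate c d := by
  obtain ⟨j, rfl⟩ := Nat.exists_eq_add_of_le' hi
  rw [thetaRate_eq]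
  exact ((summable_nat_add_iff d).2 hs).le_tsum j fun i _ => sq_nonneg _

/-- One term suffices: at the index attaining the maximum the coefficient is at least `1/2`, so its
powers cost only a constant. -/
theorem omegaRate_sq_le (hs : Summable fun i => c i ^ 2) (hd : 0 < d) (hω : omegaRate c d ≤ 1 / 2)
    (k : ℕ) :
    omegaRate c d ^ 2 ≤ 4 ^ (k + 1) * ∑' i, c i ^ (2 * k + 2) * (c i - 1) ^ 2 := by
  obtain ⟨i, hi, h⟩ := exists_omegaRate_eq (c := c) hd
  have h1 : 1 / 2 ≤ c i := by
    rw [h, abs_le] at hω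
    linarith [hω.1]
  have h2 : 1 ≤ 4 * c i ^ 2 := by nlinarith
  have h3 : 1 ≤ 4 ^ (k + 1) * c i ^ (2 * k + 2) := by
    have : 4 ^ (k + 1) * c i ^ (2 * k + 2) = (4 * c i ^ 2) ^ (k + 1) := by
      rw [mul_pow, ← pow_mul]; ring
    rw [this]
    exact one_le_pow₀ h2
  have h4 := (summable_pow_mul_sub_one_sq hs (2 * k)).le_tsum i fun j _ => by
    have : c j ^ (2 * k + 2) = (c j ^ (k + 1)) ^ 2 := by ring
    rw [this]; positivity
  rw [h, sq_abs]
  calc (c i - 1) ^ 2 ≤ 4 ^ (k + 1) * c i ^ (2 * k + 2) * (c i - 1) ^ 2 :=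
        le_mul_of_one_le_left (sq_nonneg _) h3
    _ ≤ _ := by rw [mul_assoc]; gcongr

theorem thetaRate_le_tsum (hs : Summable fun i => c i ^ 2) (hϑ : thetaRate c d ≤ 1 / 4) :
    thetaRate c d ≤ 4 * ∑' i, c i ^ 2 * (c i - 1) ^ 2 := by
  have hq := summable_pow_mul_sub_one_sq hs 0
  simp only [zero_add] at hq
  rw [← tsum_mul_left, ← (hq.mul_left 4).sum_add_tsum_nat_add d, thetaRate_eq]
  refine le_add_of_nonneg_of_le (Finset.sum_nonneg fun i _ => by positivity)
    (Summable.tsum_le_tsum (fun i => sq_le_four_mul ?_) ((summable_nat_add_iff _).2 hs)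
      ((summable_nat_add_iff (f := fun i => 4 * (c i ^ 2 * (c i - 1) ^ 2)) _).2 (hq.mul_left 4)))
  refine abs_le_of_sq_le_sq ?_ (by norm_num)
  exact ((sq_le_thetaRate hs (Nat.le_add_left d i)).trans hϑ).trans (by norm_num)

/-- In the head `|c i| ≤ 2`. In the tail each `c i ^ 2` is at most `ϑ`, so the `k` extra factors
give `ϑ ^ k`. The different powers of `ϑ` for `k = 0` and `k = 2` are the source of the equivalence.
-/
theorem tsum_le_omegaRate_add (hs : Summable fun i => c i ^ 2)
    (hω : omegaRate c d ≤ 1) (hϑ : thetaRate c d ≤ 1) (k : ℕ) :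
    ∑' i, c i ^ (2 * k + 2) * (c i - 1) ^ 2
      ≤ d * 4 ^ (k + 1) * omegaRate c d ^ 2 + 4 * thetaRate c d ^ (k + 1) := by
  have hq := summable_pow_mul_sub_one_sq hs (2 * k)
  have hθ0 := thetaRate_nonneg c d
  rw [← hq.sum_add_tsum_nat_add d]
  refine add_le_add ?_ ?_
  · have h1 : ∀ i ∈ Finset.range d, c i ^ (2 * k + 2) * (c i - 1) ^ 2
        ≤ 4 ^ (k + 1) * omegaRate c d ^ 2 := by
      intro i hi
      have h2 := abs_sub_one_le_omegaRate (c := c) (Finset.mem_range.1 hi)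
      have h3 : c i ^ 2 ≤ 4 := by
        have := abs_le.1 (h2.trans hω)
        nlinarith [this.1, this.2]
      have e : c i ^ (2 * k + 2) = (c i ^ 2) ^ (k + 1) := by rw [← pow_mul]; ring
      rw [e, ← sq_abs (c i - 1)]
      gcongr
    refine (Finset.sum_le_sum h1).trans ?_
    rw [Finset.sum_const, Finset.card_range, nsmul_eq_mul, mul_assoc]
  · have h1 : ∀ i, c (i + d) ^ (2 * k + 2) * (c (i + d) - 1) ^ 2
        ≤ 4 * thetaRate c d ^ k * c (i + d) ^ 2 := by
      intro i
      have h2 := sq_le_thetaRate hs (Nat.le_add_left d i)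
      have h3 : (c (i + d) - 1) ^ 2 ≤ 4 := by
        have := abs_le_of_sq_le_sq ((h2.trans hϑ).trans (one_pow 2).ge) zero_le_one
        rw [abs_le] at this
        nlinarith [this.1, this.2]
      have e : c (i + d) ^ (2 * k + 2) = (c (i + d) ^ 2) ^ k * c (i + d) ^ 2 := by
        rw [← pow_mul]; ring
      rw [e]
      calc _ ≤ thetaRate c d ^ k * c (i + d) ^ 2 * 4 := by gcongr
        _ = _ := by ring
    refine (Summable.tsum_le_tsum h1 ((summable_nat_add_iff
      (f := fun i => c i ^ (2 * k + 2) * (c i - 1) ^ 2) _).2 hq)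
      (((summable_nat_add_iff _).2 hs).mul_left _)).trans ?_
    rw [tsum_mul_left, ← thetaRate_eq]
    exact le_of_eq (by ring)

/-- The variance constraint turns the tail into the deficit of the head, `ϑ = ∑_{i<d} (1 - c_i²)`.
-/
theorem thetaRate_le_omegaRate (hs : Summable fun i => c i ^ 2) (hν : ∑' i, c i ^ 2 = d)
    (hω : omegaRate c d ≤ 1) : thetaRate c d ≤ 3 * d * omegaRate c d := by
  have e1 : thetaRate c d = ∑ i ∈ Finset.range d, (1 - c i ^ 2) := by
    rw [thetaRate_eq, Finset.sum_sub_distrib]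
    have := hs.sum_add_tsum_nat_add d
    rw [hν] at this
    simp
    linarith
  have h1 : ∀ i ∈ Finset.range d, 1 - c i ^ 2 ≤ 3 * omegaRate c d := by
    intro i hi
    have h2 := abs_sub_one_le_omegaRate (c := c) (Finset.mem_range.1 hi)
    have h3 := abs_le.1 h2
    nlinarith [h3.1, h3.2]
  rw [e1]
  refine (Finset.sum_le_sum h1).trans ?_
  rw [Finset.sum_const, Finset.card_range, nsmul_eq_mul]
  exact le_of_eq (by ring)

end Rates

/-! ### Comparison of the variances through the rates. -/

section Comparison

theorem isBigO_of_le {f g : ℕ → ℝ} (hf : ∀ n, 0 ≤ f n) {C : ℝ}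
    (h : ∀ᶠ n in atTop, f n ≤ C * g n) : f =O[atTop] g := by
  refine IsBigO.of_bound |C| (h.mono fun n hn => ?_)
  rw [Real.norm_of_nonneg (hf n), Real.norm_eq_abs, ← abs_mul]
  exact hn.trans (le_abs_self _)

/-- The abstract comparison of the two variances with the rates `w` and `t`. -/
theorem isTheta_iff_of_rates {A B w t : ℕ → ℝ} (hw : ∀ n, 0 ≤ w n)
    (ht : ∀ n, 0 ≤ t n) (hw0 : Tendsto w atTop (𝓝 0)) (ht0 : Tendsto t atTop (𝓝 0))
    (htA : t =O[atTop] A)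
    (hAle : A =O[atTop] fun n => w n ^ 2 + t n) (hwB : (fun n => w n ^ 2) =O[atTop] B)
    (hBle : B =O[atTop] fun n => w n ^ 2 + t n ^ 3) (htw : t =O[atTop] w) :
    (B =Θ[atTop] fun n => A n ^ 2) ↔ t =Θ[atTop] w := by
  have w1 : w =O[atTop] fun _ => (1 : ℝ) := hw0.isBigO_one ℝ
  have t1 : t =O[atTop] fun _ => (1 : ℝ) := ht0.isBigO_one ℝ
  constructor
  · rintro ⟨hBA, -⟩
    refine ⟨htw, ?_⟩
    have h1 : (fun n => w n ^ 2) =O[atTop] fun n => (w n ^ 2 + t n) ^ 2 :=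
      (hwB.trans hBA).trans (hAle.pow 2)
    -- Since `w → 0`, the term `w²` is absorbed into the left side, leaving `w = O(t)`.
    have h2 : w =O[atTop] fun n => w n ^ 2 + t n := IsBigO.of_pow two_ne_zero h1
    obtain ⟨C, hC, hb⟩ := h2.exists_pos
    rw [isBigOWith_iff] at hb
    refine isBigO_of_le hw (C := 2 * C) ?_
    filter_upwards [hb, hw0.eventually (gt_mem_nhds (show (0 : ℝ) < 1 / (2 * C) by positivity))]
      with n h3 h4
    have h5 : 0 ≤ w n ^ 2 + t n := add_nonneg (sq_nonneg _) (ht n)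
    rw [Real.norm_of_nonneg (hw n), Real.norm_of_nonneg h5] at h3
    rw [lt_div_iff₀ (by positivity)] at h4
    nlinarith [hw n, ht n]
  -- Here `B = O(w² + t³) = O(t²) = O(A²)`, and conversely `A = O(w² + t) = O(w)`, so that `A² =
  -- O(w²) = O(B)`.
  · rintro ⟨-, hwt⟩
    constructor
    · refine hBle.trans (IsBigO.trans ?_ (htA.pow 2))
      refine (hwt.pow 2).add ?_
      have := (isBigO_refl (fun n => t n ^ 2) atTop).mul t1
      simpa [pow_succ] using this
    · refine IsBigO.trans ?_ hwB
      refine IsBigO.pow (hAle.trans ?_) 2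
      refine IsBigO.add ?_ htw
      have := (isBigO_refl w atTop).mul w1
      simpa [sq] using this

/-- Only finitely many `n` escape the asymptotic bounds, and the common zero set lets the constants
be enlarged to include them. -/
theorem exists_constants_of_isTheta {a b : ℕ → ℝ} (ha : ∀ n, 0 ≤ a n) (hb : ∀ n, 0 ≤ b n)
    (hab : ∀ n, a n = 0 ↔ b n = 0) (h : b =Θ[atTop] a) :
    ∃ C₁ C₂ : ℝ, 0 < C₁ ∧ C₁ < C₂ ∧ ∀ n, C₁ * a n ≤ b n ∧ b n ≤ C₂ * a n := by
  obtain ⟨C, hC⟩ := (isBigO_nat_atTop_iff fun n => (hab n).1).1 h.1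
  obtain ⟨C', hC'⟩ := (isBigO_nat_atTop_iff fun n => (hab n).2).1 h.2
  -- The truncations guarantee `C₁ ≤ 1 < 2 ≤ C₂`.
  refine ⟨(max C' 1)⁻¹, max C 0 + 2, by positivity, ?_, fun n => ⟨?_, ?_⟩⟩
  · have h1 : (max C' 1)⁻¹ ≤ 1 := inv_le_one_of_one_le₀ (le_max_right _ _)
    linarith [le_max_right C 0]
  · have h1 := hC' n
    rw [Real.norm_of_nonneg (ha n), Real.norm_of_nonneg (hb n)] at h1
    rw [inv_mul_le_iff₀ (by positivity)]
    exact h1.trans (mul_le_mul_of_nonneg_right (le_max_left _ _) (hb n))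
  · have h1 := hC n
    rw [Real.norm_of_nonneg (ha n), Real.norm_of_nonneg (hb n)] at h1
    refine h1.trans (mul_le_mul_of_nonneg_right ?_ (ha n))
    linarith [le_max_left C 0]

/-- The right side does not involve `k`, so the two variances vanish for the same `n`. -/
theorem tsum_eq_zero_iff_pow {c : ℕ → ℝ} (hs : Summable fun i => c i ^ 2) (k : ℕ) :
    ∑' i, c i ^ (2 * k + 2) * (c i - 1) ^ 2 = 0 ↔ ∀ i, c i = 0 ∨ c i = 1 := by
  have hnn : ∀ i, 0 ≤ c i ^ (2 * k + 2) * (c i - 1) ^ 2 := fun i => by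
    have : c i ^ (2 * k + 2) = (c i ^ (k + 1)) ^ 2 := by ring
    rw [this]; positivity
  rw [← (summable_pow_mul_sub_one_sq hs (2 * k)).hasSum_iff, hasSum_zero_iff_of_nonneg hnn,
    funext_iff]
  refine forall_congr' fun i => ?_
  simp [sub_eq_zero]

end Comparison

/-! ### Variances in terms of coefficients, and the comparison for coefficient sequences. -/

section Main

variable {H Ω : Type*} [NormedAddCommGroup H] [InnerProductSpace ℝ H] [CompleteSpace H]
  [TopologicalSpace.SeparableSpace H] [MeasurableSpace Ω] {P : Measure Ω} [IsProbabilityMeasure P]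
  {X : H → Ω → ℝ} {e : ℕ → H} {c : ℕ → ℝ}

theorem IsChaosCoeff.variance_gammaOp_eq (hX : IsIsonormal X P) (hc : IsChaosCoeff e c) {F : Ω → ℝ}
    (hF : F =ᵐ[P] chaosSum hX e c 0) (k : ℕ) :
    Var[fun ω => gammaOp X P (k + 1) F ω - 2 * gammaOp X P k F ω; P]
      = 8 * 4 ^ k * ∑' i, c i ^ (2 * k + 2) * (c i - 1) ^ 2 := by
  rw [hc.variance_gammaOp_sub hX hF k, ← tsum_mul_left, ← tsum_mul_left]
  congr 1; ext i
  have e4 : (4 : ℝ) ^ k = (2 ^ k) ^ 2 := by rw [← pow_mul, mul_comm, pow_mul]; norm_num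
  rw [e4]
  ring

/-- The system `e`, set to zero beyond the index `M`. -/
noncomputable def truncateFamily (e : ℕ → H) (M : ℕ∞) : ℕ → H :=
  open Classical in fun i => if (i : ℕ∞) < M then e i else 0

theorem truncateFamily_of_lt {M : ℕ∞} {i : ℕ} (h : (i : ℕ∞) < M) : truncateFamily e M i = e i :=
  if_pos h

theorem truncateFamily_of_le {M : ℕ∞} {i : ℕ} (h : M ≤ i) : truncateFamily e M i = 0 :=
  if_neg (not_lt.2 h)

theorem pairwise_truncateFamily {M : ℕ∞}
    (he : Orthonormal ℝ (fun i : {i : ℕ // (i : ℕ∞) < M} => e i)) :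
    Pairwise fun i j => ⟪truncateFamily e M i, truncateFamily e M j⟫ = 0 := by
  intro i j hij
  rcases lt_or_ge (i : ℕ∞) M with hi | hi
  · rcases lt_or_ge (j : ℕ∞) M with hj | hj
    · simp only [truncateFamily_of_lt hi, truncateFamily_of_lt hj]
      exact he.2 (i := ⟨i, hi⟩) (j := ⟨j, hj⟩) (by simpa using hij)
    · simp only [truncateFamily_of_le hj, inner_zero_right]
  · simp only [truncateFamily_of_le hi, inner_zero_left]

end Main

/-- The comparison of the variances of `Γ₃ - 2Γ₂` and `Γ₁ - 2F` for coefficient sequences satisfying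
`∑ c_i² = ν` and `∑ c_i² (c_i - 1)² → 0`. -/
theorem variance_comparison {c : ℕ → ℕ → ℝ} {ν : ℝ} (hν0 : 0 < ν)
    (hs : ∀ n, Summable fun i => c n i ^ 2) (ha : ∀ n, Antitone fun i => |c n i|)
    (hν : ∀ n, ∑' i, c n i ^ 2 = ν)
    (hlim : Tendsto (fun n => ∑' i, c n i ^ 2 * (c n i - 1) ^ 2) atTop (𝓝 0)) {V W : ℕ → ℝ}
    (hV : ∀ n, V n = 8 * 4 ^ 0 * ∑' i, c n i ^ (2 * 0 + 2) * (c n i - 1) ^ 2)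
    (hW : ∀ n, W n = 8 * 4 ^ 2 * ∑' i, c n i ^ (2 * 2 + 2) * (c n i - 1) ^ 2) :
    ∃ d : ℕ, (d : ℝ) = ν ∧
      ((W =Θ[atTop] fun n => V n ^ 2) ↔
        (fun n => thetaRate (c n) d) =Θ[atTop] fun n => omegaRate (c n) d) ∧
      (((fun n => thetaRate (c n) d) =Θ[atTop] fun n => omegaRate (c n) d) →
        ∃ C₁ C₂ : ℝ, 0 < C₁ ∧ C₁ < C₂ ∧ ∀ n, C₁ * V n ^ 2 ≤ W n ∧ W n ≤ C₂ * V n ^ 2) := by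
  obtain ⟨d, hd, hev⟩ := exists_nat_eq_of_tendsto hs ha hν hlim
  have hdpos : 0 < d := by
    rw [← hd] at hν0
    exact_mod_cast hν0
  have hW0 : ∀ n, 0 ≤ W n := fun n => by
    rw [hW]
    refine mul_nonneg (by norm_num) (tsum_nonneg fun i => ?_)
    have : c n i ^ (2 * 2 + 2) = (c n i ^ 3) ^ 2 := by ring
    rw [this]; positivity
  have hV0 : ∀ n, 0 ≤ V n := fun n => by
    rw [hV]
    refine mul_nonneg (by norm_num) (tsum_nonneg fun i => ?_)
    have : c n i ^ (2 * 0 + 2) = c n i ^ 2 := by ring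
    rw [this]; positivity
  have hw0 : Tendsto (fun n => omegaRate (c n) d) atTop (𝓝 0) := by
    have h1 := (hlim.const_mul 4).sqrt
    rw [mul_zero, Real.sqrt_zero] at h1
    refine squeeze_zero' (Eventually.of_forall fun n => omegaRate_nonneg _ _) ?_ h1
    filter_upwards [hev] with n hn
    obtain ⟨i, hi, h⟩ := exists_omegaRate_eq (c := c n) hdpos
    rw [h]
    exact Real.abs_le_sqrt (hn.1 i hi)
  have ht0 : Tendsto (fun n => thetaRate (c n) d) atTop (𝓝 0) := by
    have h1 := hlim.const_mul 4
    rw [mul_zero] at h1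
    refine squeeze_zero' (Eventually.of_forall fun n => thetaRate_nonneg _ _) ?_ h1
    filter_upwards [hev] with n hn
    exact hn.2
  have hwe : ∀ᶠ n in atTop, omegaRate (c n) d ≤ 1 / 2 :=
    (hw0.eventually (gt_mem_nhds (by norm_num : (0 : ℝ) < 1 / 2))).mono fun n hn => hn.le
  have hte : ∀ᶠ n in atTop, thetaRate (c n) d ≤ 1 / 4 :=
    (ht0.eventually (gt_mem_nhds (by norm_num : (0 : ℝ) < 1 / 4))).mono fun n hn => hn.le
  have hiff : (W =Θ[atTop] fun n => V n ^ 2) ↔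
      (fun n => thetaRate (c n) d) =Θ[atTop] fun n => omegaRate (c n) d := by
    refine isTheta_iff_of_rates (fun n => omegaRate_nonneg _ _) (fun n => thetaRate_nonneg _ _)
      hw0 ht0 ?_ ?_ ?_ ?_ ?_
    · refine isBigO_of_le (fun n => thetaRate_nonneg _ _) (C := 1 / 2) ?_
      filter_upwards [hte] with n hn
      have := thetaRate_le_tsum (hs n) hn
      rw [hV]
      norm_num
      linarith
    · refine isBigO_of_le hV0 (C := 8 * (4 * d + 4)) ?_
      filter_upwards [hwe, hte] with n h1 h2
      have := tsum_le_omegaRate_add (hs n) (d := d) (h1.trans (by norm_num))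
        (h2.trans (by norm_num)) 0
      rw [hV]
      simp only [zero_add, pow_one, pow_zero, mul_one] at this ⊢
      have p1 : 0 ≤ d * thetaRate (c n) d := mul_nonneg d.cast_nonneg (thetaRate_nonneg _ _)
      nlinarith [sq_nonneg (omegaRate (c n) d)]
    -- The constant is `4 ^ 3` from `omegaRate_sq_le` divided by the prefactor `8 * 4 ^ 2`.
    · refine isBigO_of_le (fun n => sq_nonneg _) (C := 1 / 2) ?_
      filter_upwards [hwe] with n hn
      have := omegaRate_sq_le (hs n) hdpos hn 2
      rw [hW]
      norm_num at this ⊢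
      linarith
    · refine isBigO_of_le hW0 (C := 128 * (64 * d + 4)) ?_
      filter_upwards [hwe, hte] with n h1 h2
      have := tsum_le_omegaRate_add (hs n) (d := d) (h1.trans (by norm_num))
        (h2.trans (by norm_num)) 2
      rw [hW]
      norm_num at this ⊢
      have p0 := thetaRate_nonneg (c n) d
      have p1 : 0 ≤ d * thetaRate (c n) d ^ 3 := by positivity
      nlinarith [sq_nonneg (omegaRate (c n) d)]
    · refine isBigO_of_le (fun n => thetaRate_nonneg _ _) (C := 3 * d) ?_
      filter_upwards [hwe] with n hn
      exact thetaRate_le_omegaRate (hs n) ((hν n).trans hd.symm) (hn.trans (by norm_num))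
  refine ⟨d, hd, hiff, fun hΘ => ?_⟩
  refine exists_constants_of_isTheta (fun n => sq_nonneg _) hW0 (fun n => ?_) (hiff.2 hΘ)
  rw [pow_eq_zero_iff two_ne_zero, hV, hW, mul_eq_zero_iff_left (by norm_num),
    mul_eq_zero_iff_left (by norm_num), tsum_eq_zero_iff_pow (hs n), tsum_eq_zero_iff_pow (hs n)]

end GammaChaos

/-! ### Assembly of the main theorem. -/

theorem mainTheorem11
    {H : Type*} [NormedAddCommGroup H] [InnerProductSpace ℝ H] [CompleteSpace H]
    [TopologicalSpace.SeparableSpace H]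
    {Ω : Type*} [MeasurableSpace Ω] (P : Measure Ω) [IsProbabilityMeasure P]
    (X : H → Ω → ℝ) (hX : GammaChaos.IsIsonormal X P)
    -- the parameter `ν` and the target `G ~ CenteredGamma(ν)`
    (ν : ℝ) (hν : 0 < ν)
    {Ω' : Type*} [MeasurableSpace Ω'] (P' : Measure Ω') [IsProbabilityMeasure P']
    (G : Ω' → ℝ) (hG : HasLaw G (GammaChaos.centeredGamma ν) P')
    -- the numbers of terms `M n ↑ ∞`, possibly infinite
    (M : ℕ → ℕ∞) (hM_mono : Monotone M) (hM : Tendsto M atTop (𝓝 ⊤))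
    -- the coefficients, indexed from `0`, extended by `0` beyond `M n`, in descending absolute value
    (c : ℕ → ℕ → ℝ) (hc_zero : ∀ n (i : ℕ), M n ≤ (i : ℕ∞) → c n i = 0)
    (hc_anti : ∀ n, Antitone (fun i => |c n i|))
    -- `N_{i,n} = X (e n i)` for an orthonormal system `(e n i)_{i < M n}`
    (e : ℕ → ℕ → H) (he : ∀ n, Orthonormal ℝ (fun i : {i : ℕ // (i : ℕ∞) < M n} => e n i))
    -- `F n = ∑_{i < M n} c n i * (N_{i,n} ^ 2 - 1)`, with convergence in `L²`
    (F : ℕ → Ω → ℝ) (hF : ∀ n, MemLp (F n) 2 P)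
    (hF_repr : ∀ n, Tendsto (fun m : ℕ =>
        eLpNorm (fun ω => F n ω - ∑ i ∈ Finset.range m, c n i * ((X (e n i) ω) ^ 2 - 1)) 2 P)
      atTop (𝓝 0))
    (hF_var : ∀ n, ∫ ω, (F n ω) ^ 2 ∂P = 2 * ν)
    (hF_lim : TendstoInDistribution F atTop G (fun _ => P) P') :
    ∃ d : ℕ, (d : ℝ) = ν ∧
      (((fun n => Var[fun ω => GammaChaos.gammaOp X P 3 (F n) ω
              - 2 * GammaChaos.gammaOp X P 2 (F n) ω; P])
          =Θ[atTop] (fun n => Var[fun ω => GammaChaos.gammaOp X P 1 (F n) ω - 2 * F n ω; P] ^ 2))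
        ↔ ((fun n => GammaChaos.thetaRate (c n) d)
          =Θ[atTop] (fun n => GammaChaos.omegaRate (c n) d))) ∧
      (((fun n => GammaChaos.thetaRate (c n) d)
          =Θ[atTop] (fun n => GammaChaos.omegaRate (c n) d)) →
        ∃ C₁ C₂ : ℝ, 0 < C₁ ∧ C₁ < C₂ ∧ ∀ n,
          C₁ * Var[fun ω => GammaChaos.gammaOp X P 1 (F n) ω - 2 * F n ω; P] ^ 2
              ≤ Var[fun ω => GammaChaos.gammaOp X P 3 (F n) ω
                  - 2 * GammaChaos.gammaOp X P 2 (F n) ω; P] ∧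
          Var[fun ω => GammaChaos.gammaOp X P 3 (F n) ω
                  - 2 * GammaChaos.gammaOp X P 2 (F n) ω; P]
              ≤ C₂ * Var[fun ω => GammaChaos.gammaOp X P 1 (F n) ω - 2 * F n ω; P] ^ 2) := by
  -- Beyond `M n` the vectors `e n i` are arbitrary; setting them to zero gives a family orthogonal
  -- over all of `ℕ`, at no cost because the coefficients vanish there.
  set e' : ℕ → ℕ → H := fun n => GammaChaos.truncateFamily (e n) (M n) with he'
  have hlt : ∀ n i, c n i ≠ 0 → (i : ℕ∞) < M n := fun n i h =>
    lt_of_not_ge fun h' => h (hc_zero n i h')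
  have hunit : ∀ n i, c n i ≠ 0 → ‖e' n i‖ = 1 := by
    intro n i h
    simp only [he', GammaChaos.truncateFamily_of_lt (hlt n i h)]
    exact (he n).1 ⟨i, hlt n i h⟩
  have hchaos : ∀ n, GammaChaos.IsChaosCoeff (e' n) (c n) ∧
      F n =ᵐ[P] GammaChaos.chaosSum hX (e' n) (c n) 0 := by
    intro n
    refine GammaChaos.ae_eq_chaosSum hX (GammaChaos.pairwise_truncateFamily (he n)) (hunit n)
      (hF n) ?_
    refine (hF_repr n).congr fun m => ?_
    congr 1; ext ω; congr 1
    refine Finset.sum_congr rfl fun i _ => ?_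
    by_cases h : c n i = 0
    · simp [h]
    · simp only [GammaChaos.truncateFamily_of_lt (hlt n i h)]
  have hs : ∀ n, Summable fun i => c n i ^ 2 := fun n => (hchaos n).1.summable
  have hsq : ∀ n, ∑' i, c n i ^ 2 = ν := by
    intro n
    have h1 := (hchaos n).1.integral_chaosSum_sq hX
    have h2 : ∫ ω, F n ω ^ 2 ∂P = ∫ ω, GammaChaos.chaosSum hX (e' n) (c n) 0 ω ^ 2 ∂P := by
      refine integral_congr_ae ?_
      filter_upwards [(hchaos n).2] with ω hω
      rw [hω]
    rw [hF_var n, h1] at h2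
    linarith
  obtain ⟨h3, h4⟩ := GammaChaos.tendsto_powerSums hX hν hG (fun n => (hchaos n).1)
    (fun n => (hchaos n).2) hsq hF_lim
  -- Expanding the square gives `∑ c⁴ - 2 ∑ c³ + ∑ c²`, with limit `ν - 2ν + ν`.
  have hlim : Tendsto (fun n => ∑' i, c n i ^ 2 * (c n i - 1) ^ 2) atTop (𝓝 0) := by
    simp only [fun n => GammaChaos.tsum_sq_mul_sub_one_sq (hs n), hsq]
    have := (h4.sub (h3.const_mul 2)).add_const ν
    convert! this using 2
    ring
  exact GammaChaos.variance_comparison hν hs hc_anti hsq hlim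
    (fun n => (hchaos n).1.variance_gammaOp_eq hX (hchaos n).2 0)
    (fun n => (hchaos n).1.variance_gammaOp_eq hX (hchaos n).2 2)
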